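/- Let $k$ be an algebraically closed field of characteristic $0$ (for instance $k=\mathbb{C}$). Let $\mathcal{H}_3$ be the moduli space of genus 3 hyperelliptic curves $Y^2=f(X,Z)$ over $k$: its points are the $GL_2(k)$-orbits of binary octavics $f$ with nonzero discriminant, and its coordinate ring $k[\mathcal{H}_3]$ is the ring of $GL_2(k)$-invariant regular functions on the space of such octavics. Let $\mathcal{L}_3\subset\mathcal{H}_3$ be the locus of the curves whose automorphism group contains an involution other than the hyperelliptic one (an extra involution). Then the ideal of the functions in $k[\mathcal{H}_3]$ that vanish on $\mathcal{L}_3$ is prime; let $k(\mathcal{L}_3)$ be the fraction field of the quotient of $k[\mathcal{H}_3]$ by it. Pull-back along the rational map that sends $(a_1,a_2,a_3)$ to the class of the curve with normal equation $$Y^2=X^8+a_3X^6+a_2X^4+a_1X^2+1$$ is an embedding of $k(\mathcal{L}_3)$ into the rational function field $k(a_1,a_2,a_3)$, and its image is the field generated by the dihedral invariants: $$k(\mathcal{L}_3)=k(u_1,u_2,u_3),\qquad u_1=a_1^4+a_3^4,\quad u_2=(a_1^2+a_3^2)\,a_2,\quad u_3=2a_1a_3.$$ Moreover $u_1,u_2,u_3$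 are algebraically independent over $k$. Hence the rational function field of affine 3-space with coordinates $u_1,u_2,u_3$ is isomorphic over $k$ to $k(\mathcal{L}_3)$ by the isomorphism that sends the $i$-th coordinate to $u_i$; that is, $u_1,u_2,u_3$ give a birational parametrization of $\mathcal{L}_3$ by affine 3-space. -/

import Mathlib

namespace HyperellipticGenusThree

noncomputable section

/-- The binary octavic `∑ i, c i * X ^ i * Z ^ (8 - i)` with coefficient vector `c`,
in the variables `X = X 0`, `Z = X 1`. -/
def octavic {k : Type*} [Field k] (c : Fin 9 → k) : MvPolynomial (Fin 2) k :=
  ∑ i : Fin 9, MvPolynomial.C (c i) *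
    MvPolynomial.X 0 ^ (i : ℕ) * MvPolynomial.X 1 ^ (8 - (i : ℕ))

/-- The octavic is nonsingular: its partial derivatives have no common zero other than the
origin. In characteristic zero this says that its eight zeros on the projective line are
distinct (its discriminant is nonzero), i.e. that `Y ^ 2 = f(X, Z)` is a smooth hyperelliptic
curve of genus 3. -/
def IsNonsingular {k : Type*} [Field k] (c : Fin 9 → k) : Prop :=
  ∀ v : Fin 2 → k,
    (∀ i, MvPolynomial.eval v (MvPolynomial.pderiv i (octavic c)) = 0) → v = 0

/-- The parameter space of genus 3 hyperelliptic curves `Y ^ 2 = f(X, Z)`: the complement of the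
discriminant hypersurface in the affine space of binary octavics. -/
abbrev Octavics (k : Type*) [Field k] : Type _ := {c : Fin 9 → k // IsNonsingular c}

/-- The action of `GL₂` on binary forms by the substitution
`X ↦ aX + bZ`, `Z ↦ cX + dZ`. -/
def subst {k : Type*} [Field k] (M : GL (Fin 2) k) :
    MvPolynomial (Fin 2) k →ₐ[k] MvPolynomial (Fin 2) k :=
  MvPolynomial.aeval fun i => ∑ j, MvPolynomial.C ((M : Matrix (Fin 2) (Fin 2) k) i j) *
    MvPolynomial.X j

/-- Two octavics lie in the same `GL₂`-orbit (over an algebraically closed field: the two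
hyperelliptic curves are isomorphic). -/
def Equivalent {k : Type*} [Field k] (c c' : Octavics k) : Prop :=
  ∃ M : GL (Fin 2) k, octavic c'.1 = subst M (octavic c.1)

/-- The points of the moduli space `ℋ₃` of genus 3 hyperelliptic curves: the `GL₂`-orbits of
nonsingular binary octavics. -/
def H3 (k : Type*) [Field k] : Type _ := Quot (Equivalent (k := k))

/-- The moduli point of the curve `Y ^ 2 = f(X, Z)`. -/
def moduliPoint {k : Type*} [Field k] (c : Octavics k) : H3 k := Quot.mk _ c

/-- `φ = P / D` on the parameter space, with a denominator `D` that vanishes nowhere on it. -/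
def Represents {k : Type*} [Field k] (P D : MvPolynomial (Fin 9) k) (φ : H3 k → k) : Prop :=
  ∀ c : Octavics k, MvPolynomial.eval c.1 D ≠ 0 ∧
    φ (moduliPoint c) * MvPolynomial.eval c.1 D = MvPolynomial.eval c.1 P

/-- The coordinate ring of the affine variety `ℋ₃`: the functions on `ℋ₃` whose pull-back to the
parameter space is regular, that is, the `GL₂`-invariant regular functions of nonsingular octavics
(quotients of an invariant by a power of the discriminant, of total degree zero). As the parameter
space is the complement of a hypersurface in affine space, a regular function on it is a
quotient of two polynomials the second of which vanishes nowhere on it. -/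
def coordRing (k : Type*) [Field k] : Subalgebra k (H3 k → k) where
  carrier := {φ | ∃ P D, Represents P D φ}
  mul_mem' := by
    rintro φ ψ ⟨P, D, h⟩ ⟨Q, E, h'⟩
    refine ⟨P * Q, D * E, fun c => ⟨?_, ?_⟩⟩
    · rw [map_mul]
      exact mul_ne_zero (h c).1 (h' c).1
    · rw [map_mul, map_mul, ← (h c).2, ← (h' c).2, Pi.mul_apply]
      ring
  add_mem' := by
    rintro φ ψ ⟨P, D, h⟩ ⟨Q, E, h'⟩
    refine ⟨P * E + Q * D, D * E, fun c => ⟨?_, ?_⟩⟩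
    · rw [map_mul]
      exact mul_ne_zero (h c).1 (h' c).1
    · rw [map_mul, map_add, map_mul, map_mul, ← (h c).2, ← (h' c).2, Pi.add_apply]
      ring
  algebraMap_mem' := by
    intro r
    refine ⟨MvPolynomial.C r, 1, fun c => ⟨?_, ?_⟩⟩ <;> simp

/-- The dehomogenized polynomial `f(x, 1)`. -/
def affinePoly {k : Type*} [Field k] (c : Fin 9 → k) : Polynomial k :=
  ∑ i : Fin 9, Polynomial.C (c i) * Polynomial.X ^ (i : ℕ)

/-- The function field `k(x)[y] / (y ^ 2 - f(x, 1))` of the curve `Y ^ 2 = f(X, Z)`. -/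
abbrev CurveField {k : Type*} [Field k] (c : Fin 9 → k) : Type _ :=
  AdjoinRoot (Polynomial.X ^ 2 -
    Polynomial.C (algebraMap (Polynomial k) (RatFunc k) (affinePoly c)))

/-- The automorphism group of the smooth projective curve `Y ^ 2 = f(X, Z)`, as the group of
`k`-automorphisms of its function field. -/
abbrev CurveAut {k : Type*} [Field k] (c : Fin 9 → k) : Type _ :=
  CurveField c ≃ₐ[k] CurveField c

/-- `σ` is the hyperelliptic involution `(x, y) ↦ (x, -y)`. -/
def IsHyperellipticInvolution {k : Type*} [Field k] {c : Fin 9 → k} (σ : CurveAut c) : Prop :=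
  (∀ r : RatFunc k, σ (AdjoinRoot.of _ r) = AdjoinRoot.of _ r) ∧
    σ (AdjoinRoot.root _) = -AdjoinRoot.root _

/-- The curve has an extra involution: a non-hyperelliptic involution in its automorphism
group. -/
def HasExtraInvolution {k : Type*} [Field k] (c : Fin 9 → k) : Prop :=
  ∃ σ : CurveAut c, orderOf σ = 2 ∧ ¬ IsHyperellipticInvolution σ

/-- The locus `ℒ₃` in `ℋ₃` of the genus 3 hyperelliptic curves with an extra involution. -/
def L3 (k : Type*) [Field k] : Set (H3 k) :=
  {p | ∃ c : Octavics k, HasExtraInvolution c.1 ∧ moduliPoint c = p}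

/-- The coordinate ring of `ℋ₃` as a type. -/
def CoordRingH3 (k : Type*) [Field k] : Type _ := coordRing k

instance (k : Type*) [Field k] : CommRing (CoordRingH3 k) :=
  inferInstanceAs (CommRing (coordRing k))

instance (k : Type*) [Field k] : Algebra k (CoordRingH3 k) :=
  inferInstanceAs (Algebra k (coordRing k))

/-- The underlying function `ℋ₃ → k` of an element of the coordinate ring. -/
def CoordRingH3.toFun {k : Type*} [Field k] : CoordRingH3 k →ₐ[k] (H3 k → k) :=
  (coordRing k).val

/-- The ideal of the regular functions on `ℋ₃` that vanish on `ℒ₃`. -/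
def idealL3 (k : Type*) [Field k] : Ideal (CoordRingH3 k) where
  carrier := {φ | ∀ p ∈ L3 k, φ.toFun p = 0}
  zero_mem' := fun p _ => by rw [map_zero, Pi.zero_apply]
  add_mem' := by
    intro φ ψ h h' p hp
    rw [map_add, Pi.add_apply, h p hp, h' p hp, add_zero]
  smul_mem' := by
    intro φ ψ h p hp
    rw [smul_eq_mul, map_mul, Pi.mul_apply, h p hp, mul_zero]

/-- The coordinate ring of (the Zariski closure in `ℋ₃` of) `ℒ₃`. -/
def CoordRingL3 (k : Type*) [Field k] : Type _ := CoordRingH3 k ⧸ idealL3 k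

instance (k : Type*) [Field k] : CommRing (CoordRingL3 k) :=
  inferInstanceAs (CommRing (CoordRingH3 k ⧸ idealL3 k))

instance (k : Type*) [Field k] : Algebra k (CoordRingL3 k) :=
  inferInstanceAs (Algebra k (CoordRingH3 k ⧸ idealL3 k))

/-- The restriction of regular functions from `ℋ₃` to `ℒ₃`. -/
def restrictL3 (k : Type*) [Field k] : CoordRingH3 k →ₐ[k] CoordRingL3 k :=
  Ideal.Quotient.mkₐ k (idealL3 k)

/-- The function field `k(ℒ₃)`: the fraction field of the coordinate ring of `ℒ₃`. -/
abbrev FunctionFieldL3 (k : Type*) [Field k] : Type _ := FractionRing (CoordRingL3 k)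

/-- The restriction to `ℒ₃` of a regular function on `ℋ₃`, as an element of `k(ℒ₃)`. -/
def restrict {k : Type*} [Field k] (φ : CoordRingH3 k) : FunctionFieldL3 k :=
  algebraMap (CoordRingL3 k) (FunctionFieldL3 k) (restrictL3 k φ)

/-- The field `k(a₁, a₂, a₃)` of rational functions in three variables. -/
abbrev RatFunc3 (k : Type*) [Field k] : Type _ := FractionRing (MvPolynomial (Fin 3) k)

/-- The variables of `RatFunc3 k`; as coefficients of the normal equation `a₁, a₂, a₃` are
`var k 0, var k 1, var k 2`. -/
def var (k : Type*) [Field k] (i : Fin 3) : RatFunc3 k :=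
  algebraMap (MvPolynomial (Fin 3) k) (RatFunc3 k) (MvPolynomial.X i)

/-- The coefficient vector of the generic normal equation
`Y ^ 2 = X ^ 8 + a₃ X ^ 6 + a₂ X ^ 4 + a₁ X ^ 2 + 1`. -/
def normalForm (k : Type*) [Field k] : Fin 9 → RatFunc3 k :=
  ![1, 0, var k 0, 0, var k 1, 0, var k 2, 0, 1]

/-- `ρ` is the pull-back of rational functions along the map that sends `(a₁, a₂, a₃)` to the
moduli point of the curve with that normal equation: a regular function `P / D` on `ℋ₃` goes to
the rational function obtained by evaluating it at the generic normal equation. -/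
def IsPullback {k : Type*} [Field k] (ρ : FunctionFieldL3 k →ₐ[k] RatFunc3 k) : Prop :=
  ∀ (φ : CoordRingH3 k) (P D : MvPolynomial (Fin 9) k), Represents P D φ.toFun →
    MvPolynomial.aeval (normalForm k) D ≠ 0 ∧
    ρ (restrict φ) =
      MvPolynomial.aeval (normalForm k) P / MvPolynomial.aeval (normalForm k) D

/-- The dihedral invariants `u₁, u₂, u₃` of genus 3. -/
def dihedral (k : Type*) [Field k] : Fin 3 → RatFunc3 k :=
  ![var k 0 ^ 4 + var k 2 ^ 4, (var k 0 ^ 2 + var k 2 ^ 2) * var k 1, 2 * var k 0 * var k 2]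

end

end HyperellipticGenusThree

/-!
Two different pictures of `ℒ₃` are compared: the family of normal equations, and quotients of
invariants of binary octavics.

*Extra involutions and normal equations.* On the curve `y ^ 2 = f(x)` the function field `k(x)(y)`
contains the rational subfield of degree two `k(x)` only once: if an automorphism `σ` did not map
`k(x)` to itself, then `x` and `σ x` would satisfy an irreducible relation of degree two in both,
whose discriminant is a polynomial of degree at most four in `x` and differs from `f` by a square
factor; but `f` is squarefree of degree at least seven (`IsHyperelliptic.exists_algEquiv_X_eq`). So
an extra involution acts on `x` by a traceless Möbius transformation that fixes `f`
(`IsHyperelliptic.exists_matrix`); once its matrix is diagonal, `f` is even, and scaling of the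
variables gives a normal equation (`exists_equivalent_evenOctavic`). Conversely `x ↦ -x` is an
extra involution of every normal equation. As nonsingular normal equations are dense, a regular
function on `ℋ₃` vanishes on `ℒ₃` if and only if its pull-back to `k(a₁, a₂, a₃)` is zero
(`mem_idealL3_iff`). Hence the ideal is prime and the pull-back embeds `k(ℒ₃)`.

*The image contains the dihedral invariants.* The quotient of two invariants of the same degree is
a rational function on `ℋ₃`, a power of the discriminant serving as a common denominator. The
transvectant with `f` is an operator on quartics, and `(f, f)₆` is a covariant quartic; contracting
the iterates of the one on the other gives invariants, the `moment`s. For even `f` the covariant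
quartic is even, so by the Cayley–Hamilton theorem on the three-dimensional space of even quartics
the moments satisfy a recurrence of length three (`moment_evenOctavic`). Its coefficients are
therefore quotients of invariants by Cramer's rule (`hankel_ne_zero`), and with the trace of the
square of the operator they yield `a₂`, `a₁ a₃`, `a₁² + a₃²` and the product `1` of the outer
coefficients as quotients of invariants with degree differences `1`, `2`, `3` and `2`. The dihedral
invariants are combinations of these with degree difference zero
(`IsInvariantQuotient.of_dihedral`).

*The image lies in the field of dihedral invariants.* The substitutions `X ↦ ηX` with `η ^ 4 = -1`
and `X ↔ Z` permute the normal equations, so pull-backs are fixed by the automorphisms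
`(a₁, a₂, a₃) ↦ (η²a₁, -a₂, -η²a₃)` and `a₁ ↔ a₃`, as are `u₁, u₂, u₃`. Now `k(a₁, a₂, a₃)` is
generated over `k(u₁, u₂, u₃)` by `a₁`, a root of `T ^ 8 - u₁ T ^ 4 + (u₃ / 2) ^ 4`. An invariant `θ` is `h(a₁)`
with `deg h < 8`, and `h` takes the value `θ` at the eight conjugates of `a₁`, so `h` is constant
(`range_pullbackField_le`).

*Algebraic independence.* The map `(a₁, a₂, a₃) ↦ (u₁, u₂, u₃)` is onto the complement of a
hypersurface (`exists_eval_dihedralMv_eq`).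
-/

namespace HyperellipticGenusThree

/-! ### The action of the general linear group on octavics -/

section
open MvPolynomial Matrix

/-- Coefficients of `f(X + tZ, Z)`, where `c` are those of the octavic `f`. -/
def shiftX {R : Type*} [CommRing R] (t : R) (c : Fin 9 → R) : Fin 9 → R :=
  ![c 0 + t * c 1 + t ^ 2 * c 2 + t ^ 3 * c 3 + t ^ 4 * c 4 + t ^ 5 * c 5 + t ^ 6 * c 6
      + t ^ 7 * c 7 + t ^ 8 * c 8,
    c 1 + 2 * t * c 2 + 3 * t ^ 2 * c 3 + 4 * t ^ 3 * c 4 + 5 * t ^ 4 * c 5 + 6 * t ^ 5 * c 6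
      + 7 * t ^ 6 * c 7 + 8 * t ^ 7 * c 8,
    c 2 + 3 * t * c 3 + 6 * t ^ 2 * c 4 + 10 * t ^ 3 * c 5 + 15 * t ^ 4 * c 6 + 21 * t ^ 5 * c 7
      + 28 * t ^ 6 * c 8,
    c 3 + 4 * t * c 4 + 10 * t ^ 2 * c 5 + 20 * t ^ 3 * c 6 + 35 * t ^ 4 * c 7
      + 56 * t ^ 5 * c 8,
    c 4 + 5 * t * c 5 + 15 * t ^ 2 * c 6 + 35 * t ^ 3 * c 7 + 70 * t ^ 4 * c 8,
    c 5 + 6 * t * c 6 + 21 * t ^ 2 * c 7 + 56 * t ^ 3 * c 8,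
    c 6 + 7 * t * c 7 + 28 * t ^ 2 * c 8,
    c 7 + 8 * t * c 8,
    c 8]

/-- Coefficients of `f(Z, X)`, where `c` are those of the octavic `f`. -/
def reverse {R : Type*} (c : Fin 9 → R) : Fin 9 → R := fun i => c (Fin.rev i)

variable {k : Type*} [Field k]

/-- The substitution `X ↦ aX + bZ`, `Z ↦ cX + dZ` for a matrix that need not be invertible. -/
noncomputable def substMatrix (M : Matrix (Fin 2) (Fin 2) k) :
    MvPolynomial (Fin 2) k →ₐ[k] MvPolynomial (Fin 2) k :=
  aeval fun i => ∑ j, C (M i j) * X j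

lemma substMatrix_mul (M N : Matrix (Fin 2) (Fin 2) k) (p : MvPolynomial (Fin 2) k) :
    substMatrix (M * N) p = substMatrix N (substMatrix M p) := by
  have : substMatrix (M * N) = (substMatrix N).comp (substMatrix M) := by
    ext1 i
    simp only [substMatrix, aeval_X, AlgHom.comp_apply, Fin.sum_univ_two, Matrix.mul_apply, map_add,
      map_mul, MvPolynomial.algHom_C, MvPolynomial.algebraMap_eq]
    ring
  rw [this, AlgHom.comp_apply]

lemma coeff_octavic (c : Fin 9 → k) (i : Fin 9) :
    coeff (Finsupp.single 0 (i : ℕ) + Finsupp.single 1 (8 - (i : ℕ))) (octavic c) = c i := by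
  have h (j : Fin 9) : (C (c j) * X 0 ^ (j : ℕ) * X 1 ^ (8 - (j : ℕ)) : MvPolynomial (Fin 2) k) =
      monomial (Finsupp.single 0 (j : ℕ) + Finsupp.single 1 (8 - (j : ℕ))) (c j) := by
    rw [X_pow_eq_monomial, X_pow_eq_monomial, mul_assoc, monomial_mul, C_mul_monomial]
    simp
  rw [octavic, coeff_sum, Finset.sum_eq_single i]
  · rw [h, coeff_monomial, if_pos rfl]
  · intro j _ hj
    rw [h, coeff_monomial, if_neg]
    intro e
    have := DFunLike.congr_fun e 0
    simp at this
    exact hj (Fin.ext this)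
  · simp

lemma octavic_injective : Function.Injective (octavic (k := k)) := fun c c' h => by
  ext i
  rw [← coeff_octavic c, h, coeff_octavic]

lemma octavic_shiftX (t : k) (c : Fin 9 → k) :
    octavic (shiftX t c) = substMatrix !![1, t; 0, 1] (octavic c) := by
  simp [octavic, Fin.sum_univ_succ, shiftX, substMatrix, map_ofNat C]
  ring

lemma octavic_reverse (c : Fin 9 → k) :
    octavic (reverse c) = substMatrix !![0, 1; 1, 0] (octavic c) := by
  simp [octavic, Fin.sum_univ_succ, reverse, substMatrix, Fin.rev]
  ring

lemma octavic_diagonal (s t : k) (c : Fin 9 → k) :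
    octavic (fun i : Fin 9 => s ^ (i : ℕ) * t ^ (8 - (i : ℕ)) * c i) =
      substMatrix !![s, 0; 0, t] (octavic c) := by
  simp [octavic, Fin.sum_univ_succ, substMatrix]
  ring

lemma pderiv_substMatrix (M : Matrix (Fin 2) (Fin 2) k) (p : MvPolynomial (Fin 2) k) (i : Fin 2) :
    pderiv i (substMatrix M p) = ∑ j, C (M j i) * substMatrix M (pderiv j p) := by
  induction p using MvPolynomial.induction_on with
  | C a => simp
  | add p q hp hq => simp only [map_add, hp, hq, mul_add, Finset.sum_add_distrib]
  | mul_X p j hp =>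
    have h : pderiv i (substMatrix M (X j)) = C (M j i) := by
      fin_cases i <;> simp [substMatrix, Fin.sum_univ_two]
    rw [map_mul, Derivation.leibniz, hp, h]
    simp only [Derivation.leibniz, pderiv_X, map_add, smul_eq_mul, map_mul, Fin.sum_univ_two]
    fin_cases j <;> simp <;> ring

lemma eval_substMatrix (M : Matrix (Fin 2) (Fin 2) k) (p : MvPolynomial (Fin 2) k) (v : Fin 2 → k) :
    eval v (substMatrix M p) = eval (M *ᵥ v) p := by
  have : (aeval v).comp (substMatrix M) = aeval (R := k) (M *ᵥ v) := by
    ext1 i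
    fin_cases i <;> simp [substMatrix]
  simpa [MvPolynomial.aeval_eq_eval] using DFunLike.congr_fun this p

lemma IsNonsingular.of_substMatrix {c c' : Fin 9 → k} (hc : IsNonsingular c)
    {M : Matrix (Fin 2) (Fin 2) k} (hM : M.det ≠ 0)
    (h : octavic c' = substMatrix M (octavic c)) : IsNonsingular c' := by
  intro v hv
  have hM' : IsUnit M := (Matrix.isUnit_iff_isUnit_det M).2 hM.isUnit
  have hMT : IsUnit Mᵀ := (Matrix.isUnit_iff_isUnit_det Mᵀ).2 (by simpa using hM.isUnit)
  have key : Mᵀ *ᵥ (fun j => eval (M *ᵥ v) (pderiv j (octavic c))) = 0 := by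
    ext i
    have := hv i
    rw [h, pderiv_substMatrix] at this
    simpa [eval_substMatrix, Matrix.mulVec, dotProduct] using this
  have h1 := (Matrix.mulVec_injective_of_isUnit hMT) (key.trans (Matrix.mulVec_zero _).symm)
  have h2 := hc (M *ᵥ v) fun i => congrFun h1 i
  exact (Matrix.mulVec_injective_of_isUnit hM') (h2.trans (Matrix.mulVec_zero _).symm)

/-- Coefficients of `f(X, Z + tX)`, where `c` are those of the octavic `f`. -/
def shiftZ {R : Type*} [CommRing R] (t : R) (c : Fin 9 → R) : Fin 9 → R :=
  reverse (shiftX t (reverse c))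

lemma octavic_shiftZ (t : k) (c : Fin 9 → k) :
    octavic (shiftZ t c) = substMatrix !![1, 0; t, 1] (octavic c) := by
  rw [shiftZ, octavic_reverse, octavic_shiftX, octavic_reverse, ← substMatrix_mul,
    ← substMatrix_mul]
  congr 2
  ext i j
  fin_cases i <;> fin_cases j <;> simp [Matrix.mul_apply, Fin.sum_univ_two]

/-- `P` is an invariant of degree `d` of binary octavics: homogeneous of degree `d` (as a function),
and unchanged by the substitutions `X ↦ X + tZ` and `Z ↦ Z + tX`. -/
structure IsInvariant (d : ℕ) (P : MvPolynomial (Fin 9) k) : Prop where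
  smul : ∀ (s : k) (c : Fin 9 → k), eval (s • c) P = s ^ d * eval c P
  shiftX : ∀ (t : k) (c : Fin 9 → k), eval (shiftX t c) P = eval c P
  shiftZ : ∀ (t : k) (c : Fin 9 → k), eval (shiftZ t c) P = eval c P

/-- The substitution `M` multiplies all invariants of degree `d` by the `d`-th power of one
factor. -/
def ScalesInvariants (M : Matrix (Fin 2) (Fin 2) k) : Prop :=
  ∃ μ : k, μ ≠ 0 ∧ ∀ c : Fin 9 → k, ∃ c', octavic c' = substMatrix M (octavic c) ∧
    ∀ d P, IsInvariant d P → eval c' P = μ ^ d * eval c P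

lemma ScalesInvariants.mul {M N : Matrix (Fin 2) (Fin 2) k} (hM : ScalesInvariants M)
    (hN : ScalesInvariants N) : ScalesInvariants (M * N) := by
  obtain ⟨μ, hμ, h⟩ := hM
  obtain ⟨ν, hν, h'⟩ := hN
  refine ⟨ν * μ, mul_ne_zero hν hμ, fun c => ?_⟩
  obtain ⟨c', e, hc⟩ := h c
  obtain ⟨c'', e', hc'⟩ := h' c'
  refine ⟨c'', by rw [e', e, substMatrix_mul], fun d P hP => ?_⟩
  rw [hc' d P hP, hc d P hP]
  ring

lemma scalesInvariants_shiftX (t : k) : ScalesInvariants !![1, t; 0, 1] :=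
  ⟨1, one_ne_zero, fun c => ⟨_, octavic_shiftX t c, fun d P hP => by rw [hP.shiftX]; ring⟩⟩

lemma scalesInvariants_shiftZ (t : k) : ScalesInvariants !![1, 0; t, 1] :=
  ⟨1, one_ne_zero, fun c => ⟨_, octavic_shiftZ t c, fun d P hP => by rw [hP.shiftZ]; ring⟩⟩

lemma scalesInvariants_scalar {s : k} (hs : s ≠ 0) : ScalesInvariants !![s, 0; 0, s] := by
  refine ⟨s ^ 8, pow_ne_zero _ hs, fun c => ⟨_, octavic_diagonal s s c, fun d P hP => ?_⟩⟩
  rw [← hP.smul]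
  refine congrArg (fun c => eval c P) (funext fun i => ?_)
  rw [← pow_add, Pi.smul_apply, smul_eq_mul]
  congr 2
  omega

lemma scalesInvariants_diagonal [IsAlgClosed k] {s t : k} (hs : s ≠ 0) (ht : t ≠ 0) :
    ScalesInvariants !![s, 0; 0, t] := by
  obtain ⟨l, hl⟩ := IsAlgClosed.exists_pow_nat_eq (s * t) (n := 2) (by norm_num)
  have hl0 : l ≠ 0 := by
    rintro rfl
    exact mul_ne_zero hs ht (by rw [← hl]; ring)
  -- The factor of determinant one, `diag(u, u⁻¹)` with `u = s / l`, is a product of transvections.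
  have key := ((((scalesInvariants_scalar hl0).mul (scalesInvariants_shiftX (s / l))).mul
    (scalesInvariants_shiftZ (-(l / s)))).mul (scalesInvariants_shiftX (s / l))).mul
    (((scalesInvariants_shiftX (-1)).mul (scalesInvariants_shiftZ 1)).mul
      (scalesInvariants_shiftX (-1)))
  convert key using 1
  ext i j
  fin_cases i <;> fin_cases j <;> simp [Matrix.mul_apply, Fin.sum_univ_two] <;> field_simp <;>
    first | ring1 | linear_combination hl | linear_combination -hl

lemma scalesInvariants [IsAlgClosed k] (M : Matrix (Fin 2) (Fin 2) k) (hM : M.det ≠ 0) :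
    ScalesInvariants M := by
  refine Matrix.diagonal_transvection_induction_of_det_ne_zero _ M hM ?_ ?_
    fun A B _ _ => ScalesInvariants.mul
  · intro D hD
    rw [Matrix.det_diagonal, Fin.prod_univ_two] at hD
    convert scalesInvariants_diagonal (left_ne_zero_of_mul hD) (right_ne_zero_of_mul hD) using 1
    ext i j
    fin_cases i <;> fin_cases j <;> simp
  · rintro ⟨i, j, hij, t⟩
    fin_cases i <;> fin_cases j
    · exact absurd rfl hij
    · convert scalesInvariants_shiftX t using 1
      ext i j
      fin_cases i <;> fin_cases j <;>
        simp [Matrix.TransvectionStruct.toMatrix, Matrix.transvection]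
    · convert scalesInvariants_shiftZ t using 1
      ext i j
      fin_cases i <;> fin_cases j <;>
        simp [Matrix.TransvectionStruct.toMatrix, Matrix.transvection]
    · exact absurd rfl hij

/-- Equivalent octavics have proportional invariants: in degree `d` the ratio is `μ ^ d`. -/
lemma Equivalent.exists_eval_eq [IsAlgClosed k] {c c' : Octavics k} (h : Equivalent c c') :
    ∃ μ : k, μ ≠ 0 ∧ ∀ d P, IsInvariant d P → eval c'.1 P = μ ^ d * eval c.1 P := by
  obtain ⟨M, hM⟩ := h
  obtain ⟨μ, hμ, H⟩ := scalesInvariants (M : Matrix (Fin 2) (Fin 2) k)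
    ((Matrix.isUnit_iff_isUnit_det _).1 M.isUnit).ne_zero
  obtain ⟨c'', e, h⟩ := H c.1
  refine ⟨μ, hμ, ?_⟩
  rwa [octavic_injective (hM.trans e.symm)]

lemma IsInvariant.mul {d e : ℕ} {P Q : MvPolynomial (Fin 9) k} (hP : IsInvariant d P)
    (hQ : IsInvariant e Q) : IsInvariant (d + e) (P * Q) where
  smul s c := by rw [map_mul, hP.smul, hQ.smul, map_mul]; ring
  shiftX t c := by rw [map_mul, hP.shiftX, hQ.shiftX, map_mul]
  shiftZ t c := by rw [map_mul, hP.shiftZ, hQ.shiftZ, map_mul]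

lemma IsInvariant.add {d : ℕ} {P Q : MvPolynomial (Fin 9) k} (hP : IsInvariant d P)
    (hQ : IsInvariant d Q) : IsInvariant d (P + Q) where
  smul s c := by rw [map_add, hP.smul, hQ.smul, map_add]; ring
  shiftX t c := by rw [map_add, hP.shiftX, hQ.shiftX, map_add]
  shiftZ t c := by rw [map_add, hP.shiftZ, hQ.shiftZ, map_add]

lemma isInvariant_C (a : k) : IsInvariant 0 (C a : MvPolynomial (Fin 9) k) where
  smul s c := by simp
  shiftX t c := by simp
  shiftZ t c := by simp

lemma IsInvariant.pow {d : ℕ} {P : MvPolynomial (Fin 9) k} (hP : IsInvariant d P) (n : ℕ) :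
    IsInvariant (d * n) (P ^ n) := by
  induction n with
  | zero => simpa using isInvariant_C (1 : k)
  | succ n ih => rw [pow_succ]; exact ih.mul hP

end

/-! ### The discriminant of octavics -/

section
open MvPolynomial Matrix

section
variable {R S : Type*} [CommRing R] [CommRing S]

/-- The dehomogenized partial derivative `∂f/∂X (x, 1)`. -/
noncomputable def partialX (c : Fin 9 → R) : Polynomial R :=
  ∑ i : Fin 8, Polynomial.C ((((i : ℕ) + 1 : ℕ) : R) * c i.succ) * Polynomial.X ^ (i : ℕ)

/-- The dehomogenized partial derivative `∂f/∂Z (x, 1)`. -/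
noncomputable def partialZ (c : Fin 9 → R) : Polynomial R :=
  ∑ i : Fin 8, Polynomial.C (((8 - (i : ℕ) : ℕ) : R) * c i.castSucc) * Polynomial.X ^ (i : ℕ)

lemma partialX_map (φ : R →+* S) (c : Fin 9 → R) : (partialX c).map φ = partialX (φ ∘ c) := by
  simp only [partialX, Polynomial.map_sum, Polynomial.map_mul, Polynomial.map_pow,
    Polynomial.map_C, Polynomial.map_X, map_mul, map_natCast, Polynomial.map_natCast,
    Function.comp_apply]

lemma partialZ_map (φ : R →+* S) (c : Fin 9 → R) : (partialZ c).map φ = partialZ (φ ∘ c) := by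
  simp only [partialZ, Polynomial.map_sum, Polynomial.map_mul, Polynomial.map_pow,
    Polynomial.map_C, Polynomial.map_X, map_mul, map_natCast, Polynomial.map_natCast,
    Function.comp_apply]

lemma natDegree_partialX_le (c : Fin 9 → R) : (partialX c).natDegree ≤ 7 :=
  Polynomial.natDegree_sum_le_of_forall_le _ _ fun i _ =>
    (Polynomial.natDegree_C_mul_X_pow_le _ _).trans (by omega)

lemma natDegree_partialZ_le (c : Fin 9 → R) : (partialZ c).natDegree ≤ 7 :=
  Polynomial.natDegree_sum_le_of_forall_le _ _ fun i _ =>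
    (Polynomial.natDegree_C_mul_X_pow_le _ _).trans (by omega)

lemma coeff_partialX (c : Fin 9 → R) : (partialX c).coeff 7 = 8 * c 8 := by
  simp only [partialX, Polynomial.finsetSum_coeff, Polynomial.coeff_C_mul_X_pow]
  rw [Finset.sum_eq_single 7 (fun i _ hi => if_neg (by omega)) (by simp)]
  norm_num
  rfl

lemma coeff_partialZ (c : Fin 9 → R) : (partialZ c).coeff 7 = c 7 := by
  simp only [partialZ, Polynomial.finsetSum_coeff, Polynomial.coeff_C_mul_X_pow]
  rw [Finset.sum_eq_single 7 (fun i _ hi => if_neg (by omega)) (by simp)]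
  simp

/-- The resultant of the two partial derivatives of an octavic; it is the discriminant up to a
constant factor. -/
noncomputable def disc (c : Fin 9 → R) : R := Polynomial.resultant (partialX c) (partialZ c) 7 7

lemma disc_map (φ : R →+* S) (c : Fin 9 → R) : φ (disc c) = disc (φ ∘ c) := by
  rw [disc, disc, ← partialX_map, ← partialZ_map, Polynomial.resultant_map_map]

lemma disc_smul (s : R) (c : Fin 9 → R) : disc (s • c) = s ^ 14 * disc c := by
  have hX : partialX (s • c) = Polynomial.C s * partialX c := by
    simp only [partialX, Finset.mul_sum, Pi.smul_apply, smul_eq_mul, map_mul]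
    exact Finset.sum_congr rfl fun i _ => by ring
  have hZ : partialZ (s • c) = Polynomial.C s * partialZ c := by
    simp only [partialZ, Finset.mul_sum, Pi.smul_apply, smul_eq_mul, map_mul]
    exact Finset.sum_congr rfl fun i _ => by ring
  rw [disc, hX, hZ, Polynomial.resultant_C_mul_left, Polynomial.resultant_C_mul_right, disc]
  ring

end

variable {k : Type*} [Field k]

lemma eval_pderiv_zero (v : Fin 2 → k) (c : Fin 9 → k) :
    eval v (pderiv 0 (octavic c)) = c 1 * v 1 ^ 7 + 2 * c 2 * v 0 * v 1 ^ 6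
      + 3 * c 3 * v 0 ^ 2 * v 1 ^ 5 + 4 * c 4 * v 0 ^ 3 * v 1 ^ 4 + 5 * c 5 * v 0 ^ 4 * v 1 ^ 3
      + 6 * c 6 * v 0 ^ 5 * v 1 ^ 2 + 7 * c 7 * v 0 ^ 6 * v 1 + 8 * c 8 * v 0 ^ 7 := by
  simp [octavic, Fin.sum_univ_succ, pderiv_X, Derivation.leibniz, Derivation.leibniz_pow]
  ring

lemma eval_pderiv_one (v : Fin 2 → k) (c : Fin 9 → k) :
    eval v (pderiv 1 (octavic c)) = 8 * c 0 * v 1 ^ 7 + 7 * c 1 * v 0 * v 1 ^ 6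
      + 6 * c 2 * v 0 ^ 2 * v 1 ^ 5 + 5 * c 3 * v 0 ^ 3 * v 1 ^ 4 + 4 * c 4 * v 0 ^ 4 * v 1 ^ 3
      + 3 * c 5 * v 0 ^ 5 * v 1 ^ 2 + 2 * c 6 * v 0 ^ 6 * v 1 + c 7 * v 0 ^ 7 := by
  simp [octavic, Fin.sum_univ_succ, pderiv_X, Derivation.leibniz, Derivation.leibniz_pow]
  ring

lemma eval_partialX (x : k) (c : Fin 9 → k) :
    (partialX c).eval x = eval ![x, 1] (pderiv 0 (octavic c)) := by
  rw [eval_pderiv_zero]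
  simp [partialX, Fin.sum_univ_succ]
  ring

lemma eval_partialZ (x : k) (c : Fin 9 → k) :
    (partialZ c).eval x = eval ![x, 1] (pderiv 1 (octavic c)) := by
  rw [eval_pderiv_one]
  simp [partialZ, Fin.sum_univ_succ]
  ring

lemma eval_pderiv_octavic_smul (i : Fin 2) (z : k) (v : Fin 2 → k) (c : Fin 9 → k) :
    eval (z • v) (pderiv i (octavic c)) = z ^ 7 * eval v (pderiv i (octavic c)) := by
  fin_cases i
  · simp only [Fin.zero_eta, eval_pderiv_zero, Pi.smul_apply, smul_eq_mul]
    ring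
  · simp only [Fin.mk_one, eval_pderiv_one, Pi.smul_apply, smul_eq_mul]
    ring

lemma isNonsingular_fermat [CharZero k] : IsNonsingular (k := k) ![1, 0, 0, 0, 0, 0, 0, 0, 1] := by
  intro v hv
  have h0 := hv 0
  have h1 := hv 1
  rw [eval_pderiv_zero] at h0
  rw [eval_pderiv_one] at h1
  ext i
  fin_cases i
  · simpa using h0
  · simpa using h1

lemma disc_ne_zero [IsAlgClosed k] [CharZero k] {c : Fin 9 → k} (hc : IsNonsingular c) :
    disc c ≠ 0 := by
  have hcop : IsCoprime (partialX c) (partialZ c) := by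
    rw [Polynomial.isCoprime_iff_aeval_ne_zero_of_isAlgClosed k k]
    intro x
    by_contra! h
    have := hc ![x, 1] fun i => by
      fin_cases i
      · simpa [eval_partialX] using h.1
      · simpa [eval_partialZ] using h.2
    simpa using congrFun this 1
  have hres := Polynomial.resultant_ne_zero _ _ hcop
  by_cases h8 : c 8 = 0
  · have h7 : c 7 ≠ 0 := by
      intro h7
      have := hc ![1, 0] fun i => by
        fin_cases i
        · simp [eval_pderiv_zero, h8]
        · simp [eval_pderiv_one, h7]
      simpa using congrFun this 0
    have hd : (partialZ c).natDegree = 7 :=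
      (natDegree_partialZ_le c).antisymm (Polynomial.le_natDegree_of_ne_zero (by
        rwa [coeff_partialZ]))
    obtain ⟨m, hm⟩ := Nat.exists_eq_add_of_le (natDegree_partialX_le c)
    have := Polynomial.resultant_add_left_deg (partialX c) (partialZ c) _ 7 m le_rfl
    rw [← hm] at this
    rw [disc, this, coeff_partialZ]
    rw [hd] at hres
    exact mul_ne_zero (mul_ne_zero (pow_ne_zero _ (by norm_num)) (pow_ne_zero _ h7)) hres
  · have hd : (partialX c).natDegree = 7 :=
      (natDegree_partialX_le c).antisymm (Polynomial.le_natDegree_of_ne_zero (by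
        rw [coeff_partialX]
        exact mul_ne_zero (by norm_num) h8))
    obtain ⟨m, hm⟩ := Nat.exists_eq_add_of_le (natDegree_partialZ_le c)
    have := Polynomial.resultant_add_right_deg (partialX c) (partialZ c) 7 _ m le_rfl
    rw [← hm] at this
    rw [disc, this, coeff_partialX]
    rw [hd] at hres
    exact mul_ne_zero (pow_ne_zero _ (mul_ne_zero (by norm_num) h8)) hres

lemma isNonsingular_of_disc_ne_zero [CharZero k] {c : Fin 9 → k} (h8 : c 8 ≠ 0)
    (hD : disc c ≠ 0) : IsNonsingular c := by
  have hd : (partialX c).natDegree = 7 :=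
    (natDegree_partialX_le c).antisymm (Polynomial.le_natDegree_of_ne_zero (by
      rw [coeff_partialX]
      exact mul_ne_zero (by norm_num) h8))
  obtain ⟨m, hm⟩ := Nat.exists_eq_add_of_le (natDegree_partialZ_le c)
  have := Polynomial.resultant_add_right_deg (partialX c) (partialZ c) 7 _ m le_rfl
  rw [← hm] at this
  rw [disc, this] at hD
  have hres := right_ne_zero_of_mul hD
  have hcop : IsCoprime (partialX c) (partialZ c) := by
    by_contra hcop
    have h0 : partialX c ≠ 0 := by
      rintro h0
      simp [h0] at hd
    have := Polynomial.resultant_eq_zero_iff.2 ⟨Or.inl h0, hcop⟩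
    rw [hd] at this
    exact hres this
  intro v hv
  have h1 : v 1 = 0 := by
    by_contra h1
    have hv' : v = v 1 • ![v 0 / v 1, 1] := by
      ext i
      fin_cases i <;> simp [h1, mul_div_cancel₀]
    obtain ⟨a, b, hab⟩ := hcop
    have := congrArg (Polynomial.eval (v 0 / v 1)) hab
    have e0 := hv 0
    have e1 := hv 1
    rw [hv', eval_pderiv_octavic_smul] at e0 e1
    have e0 := (mul_eq_zero.1 e0).resolve_left (pow_ne_zero _ h1)
    have e1 := (mul_eq_zero.1 e1).resolve_left (pow_ne_zero _ h1)
    rw [← eval_partialX] at e0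
    rw [← eval_partialZ] at e1
    simp [e0, e1] at this
  have e0 := hv 0
  rw [eval_pderiv_zero, h1] at e0
  ext i
  fin_cases i
  · simpa [h8] using e0
  · exact h1

/-- The discriminant as a polynomial in the coefficients. -/
noncomputable def discPoly (k : Type*) [Field k] : MvPolynomial (Fin 9) k := disc X

lemma eval_discPoly (c : Fin 9 → k) : eval c (discPoly k) = disc c := by
  rw [discPoly, disc_map]
  congr 1
  ext i
  simp

lemma discPoly_ne_zero [IsAlgClosed k] [CharZero k] : discPoly k ≠ 0 := by
  intro h
  apply disc_ne_zero (k := k) isNonsingular_fermat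
  rw [← eval_discPoly, h, map_zero]

/-- A one-parameter family of transformations that preserve nonsingularity fixes the discriminant:
along an orbit the discriminant is a polynomial in the parameter without zeros, hence constant. -/
lemma disc_eq_of_polynomial_family [IsAlgClosed k] [CharZero k]
    (T : k → (Fin 9 → k) → (Fin 9 → k)) (hT0 : ∀ c, T 0 c = c)
    (hT : ∀ t c, IsNonsingular c → IsNonsingular (T t c))
    (h₁ : ∀ c, ∃ q : Fin 9 → Polynomial k, ∀ t, T t c = fun i => (q i).eval t)
    (h₂ : ∀ t, ∃ q : Fin 9 → MvPolynomial (Fin 9) k, ∀ c, T t c = fun i => eval c (q i))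
    (t : k) (c : Fin 9 → k) : disc (T t c) = disc c := by
  have key (c : Fin 9 → k) (hc : IsNonsingular c) : disc (T t c) = disc c := by
    obtain ⟨q, hq⟩ := h₁ c
    have hQ (t : k) : (disc q).eval t = disc (T t c) := by
      rw [← Polynomial.coe_evalRingHom, disc_map, hq]
      rfl
    have hdeg : (disc q).degree = 0 := by
      by_contra hdeg
      obtain ⟨s, hs⟩ := IsAlgClosed.exists_root _ hdeg
      rw [Polynomial.IsRoot, hQ] at hs
      exact disc_ne_zero (hT s c hc) hs
    rw [Polynomial.eq_C_of_degree_eq_zero hdeg] at hQ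
    have := hQ t
    have h0 := hQ 0
    rw [hT0, Polynomial.eval_C] at h0
    rw [← this, Polynomial.eval_C, h0]
  obtain ⟨q, hq⟩ := h₂ t
  have hE : (disc q - discPoly k) * (discPoly k * X 8) = 0 := by
    apply MvPolynomial.funext
    intro c
    have e : eval c (disc q) = disc (T t c) := by
      rw [disc_map, hq]
      rfl
    simp only [map_mul, map_sub, e, eval_discPoly, eval_X, map_zero]
    by_cases h8 : c 8 = 0
    · simp [h8]
    by_cases hD : disc c = 0
    · simp [hD]
    rw [key c (isNonsingular_of_disc_ne_zero h8 hD)]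
    simp
  have hE' := (mul_eq_zero.1 hE).resolve_right (mul_ne_zero discPoly_ne_zero (X_ne_zero 8))
  have := congrArg (eval c) (sub_eq_zero.1 hE')
  rw [disc_map, eval_discPoly] at this
  rw [← this, hq]
  rfl

lemma shiftX_map {R S : Type*} [CommRing R] [CommRing S] (φ : R →+* S) (t : R) (c : Fin 9 → R) :
    φ ∘ shiftX t c = shiftX (φ t) (φ ∘ c) := by
  ext i
  fin_cases i <;> simp [shiftX, map_ofNat φ]

lemma shiftZ_map {R S : Type*} [CommRing R] [CommRing S] (φ : R →+* S) (t : R) (c : Fin 9 → R) :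
    φ ∘ shiftZ t c = shiftZ (φ t) (φ ∘ c) := by
  ext i
  exact congrFun (shiftX_map φ t (reverse c)) (Fin.rev i)

lemma shiftX_zero {R : Type*} [CommRing R] (c : Fin 9 → R) : shiftX 0 c = c := by
  ext i
  fin_cases i <;> simp [shiftX]

lemma shiftZ_zero {R : Type*} [CommRing R] (c : Fin 9 → R) : shiftZ 0 c = c := by
  ext i
  simp [shiftZ, shiftX_zero, reverse]

lemma isInvariant_discPoly [IsAlgClosed k] [CharZero k] : IsInvariant 14 (discPoly k) where
  smul s c := by rw [eval_discPoly, eval_discPoly, disc_smul]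
  shiftX t c := by
    rw [eval_discPoly, eval_discPoly]
    refine disc_eq_of_polynomial_family shiftX shiftX_zero
      (fun t c hc => hc.of_substMatrix (by simp [Matrix.det_fin_two]) (octavic_shiftX t c))
      (fun c => ⟨shiftX Polynomial.X (Polynomial.C ∘ c), fun t => ?_⟩)
      (fun t => ⟨shiftX (C t) X, fun c => ?_⟩) t c
    · refine Eq.trans ?_ (shiftX_map (Polynomial.evalRingHom t) Polynomial.X _).symm
      congr 1
      · simp
      · ext i; simp
    · refine Eq.trans ?_ (shiftX_map (eval c) (C t) X).symm
      congr 1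
      · simp
      · ext i; simp
  shiftZ t c := by
    rw [eval_discPoly, eval_discPoly]
    refine disc_eq_of_polynomial_family shiftZ shiftZ_zero
      (fun t c hc => hc.of_substMatrix (by simp [Matrix.det_fin_two]) (octavic_shiftZ t c))
      (fun c => ⟨shiftZ Polynomial.X (Polynomial.C ∘ c), fun t => ?_⟩)
      (fun t => ⟨shiftZ (C t) X, fun c => ?_⟩) t c
    · refine Eq.trans ?_ (shiftZ_map (Polynomial.evalRingHom t) Polynomial.X _).symm
      congr 1
      · simp
      · ext i; simp
    · refine Eq.trans ?_ (shiftZ_map (eval c) (C t) X).symm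
      congr 1
      · simp
      · ext i; simp

end

/-! ### Invariants from the Hankel operator on quartics -/

section
open MvPolynomial Matrix

section
variable {R S : Type*} [CommRing R] [CommRing S]

/-- Normalized coefficients of an octavic: `280` times the coefficients with the binomial
coefficients divided out. -/
def normCoeff (c : Fin 9 → R) : Fin 9 → R :=
  ![280 * c 0, 35 * c 1, 10 * c 2, 5 * c 3, 4 * c 4, 5 * c 5, 10 * c 6, 35 * c 7, 280 * c 8]

/-- The matrix of the fourth transvectant `g ↦ (f, g)₄` with the octavic `f`, an operator on binary
quartics, in the basis of monomials `X ^ i * Z ^ (4 - i)` and up to a constant factor. -/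
def transvectant (c : Fin 9 → R) : Matrix (Fin 5) (Fin 5) R :=
  let b := normCoeff c
  !![b 4, -b 3, b 2, -b 1, b 0;
    4 * b 5, -4 * b 4, 4 * b 3, -4 * b 2, 4 * b 1;
    6 * b 6, -6 * b 5, 6 * b 4, -6 * b 3, 6 * b 2;
    4 * b 7, -4 * b 6, 4 * b 5, -4 * b 4, 4 * b 3;
    b 8, -b 7, b 6, -b 5, b 4]

/-- The quartic covariant `(f, f)₆` of the octavic `f`, up to a constant factor. -/
def quartic (c : Fin 9 → R) : Fin 5 → R :=
  let b := normCoeff c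
  ![b 0 * b 6 - 6 * b 1 * b 5 + 15 * b 2 * b 4 - 10 * b 3 ^ 2,
    2 * b 0 * b 7 - 10 * b 1 * b 6 + 18 * b 2 * b 5 - 10 * b 3 * b 4,
    b 0 * b 8 - 2 * b 1 * b 7 - 8 * b 2 * b 6 + 34 * b 3 * b 5 - 25 * b 4 ^ 2,
    2 * b 1 * b 8 - 10 * b 2 * b 7 + 18 * b 3 * b 6 - 10 * b 4 * b 5,
    b 2 * b 8 - 6 * b 3 * b 7 + 15 * b 4 * b 6 - 10 * b 5 ^ 2]

/-- The invariant bilinear form on binary quartics. -/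
def pairing (g h : Fin 5 → R) : R :=
  12 * g 0 * h 4 - 3 * g 1 * h 3 + 2 * g 2 * h 2 - 3 * g 3 * h 1 + 12 * g 4 * h 0

/-- The moments `⟨q, Aⁱ q⟩`, where `q` is the quartic covariant and `A` the transvectant operator
of `f`. -/
def moment (i : ℕ) (c : Fin 9 → R) : R :=
  pairing (quartic c) (transvectant c ^ i *ᵥ quartic c)

/-- The trace of the square of the transvectant operator. -/
def traceSq (c : Fin 9 → R) : R := (transvectant c * transvectant c).trace

lemma transvectant_map (φ : R →+* S) (c : Fin 9 → R) :
    (transvectant c).map φ = transvectant (φ ∘ c) := by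
  ext i j
  fin_cases i <;> fin_cases j <;> simp [transvectant, normCoeff, map_ofNat φ]

lemma quartic_map (φ : R →+* S) (c : Fin 9 → R) : φ ∘ quartic c = quartic (φ ∘ c) := by
  ext i
  fin_cases i <;> simp [quartic, normCoeff, map_ofNat φ]

lemma pairing_map (φ : R →+* S) (g h : Fin 5 → R) :
    φ (pairing g h) = pairing (φ ∘ g) (φ ∘ h) := by
  simp [pairing, map_ofNat φ]

lemma moment_map (φ : R →+* S) (i : ℕ) (c : Fin 9 → R) : φ (moment i c) = moment i (φ ∘ c) := by
  have h : φ ∘ (transvectant c ^ i *ᵥ quartic c) =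
      transvectant (φ ∘ c) ^ i *ᵥ quartic (φ ∘ c) := by
    ext j
    rw [Function.comp_apply, RingHom.map_mulVec, quartic_map, Matrix.map_pow, transvectant_map]
  rw [moment, pairing_map, quartic_map, h, moment]

lemma traceSq_map (φ : R →+* S) (c : Fin 9 → R) : φ (traceSq c) = traceSq (φ ∘ c) := by
  rw [traceSq, traceSq, ← transvectant_map, ← Matrix.map_mul, AddMonoidHom.map_trace φ]

/-- The substitution `X ↦ X + tZ` on quartics. -/
def quarticShift (t : R) : Matrix (Fin 5) (Fin 5) R :=
  !![1, t, t ^ 2, t ^ 3, t ^ 4;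
    0, 1, 2 * t, 3 * t ^ 2, 4 * t ^ 3;
    0, 0, 1, 3 * t, 6 * t ^ 2;
    0, 0, 0, 1, 4 * t;
    0, 0, 0, 0, 1]

/-- The substitution `X ↔ Z` on quartics. -/
def quarticReverse : Matrix (Fin 5) (Fin 5) R :=
  !![0, 0, 0, 0, 1; 0, 0, 0, 1, 0; 0, 0, 1, 0, 0; 0, 1, 0, 0, 0; 1, 0, 0, 0, 0]

lemma transvectant_shiftX (t : R) (c : Fin 9 → R) :
    transvectant (shiftX t c) * quarticShift t = quarticShift t * transvectant c := by
  ext i j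
  fin_cases i <;> fin_cases j <;>
    simp [transvectant, normCoeff, shiftX, quarticShift, Matrix.mul_apply, Fin.sum_univ_five] <;>
    ring

lemma quartic_shiftX (t : R) (c : Fin 9 → R) :
    quartic (shiftX t c) = quarticShift t *ᵥ quartic c := by
  ext i
  fin_cases i <;>
    simp [quartic, normCoeff, shiftX, quarticShift, Matrix.mulVec, dotProduct,
      Fin.sum_univ_five] <;>
    ring

lemma pairing_quarticShift (t : R) (g h : Fin 5 → R) :
    pairing (quarticShift t *ᵥ g) (quarticShift t *ᵥ h) = pairing g h := by
  simp [pairing, quarticShift, Matrix.mulVec, dotProduct, Fin.sum_univ_five]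
  ring

lemma quarticShift_mul_neg (t : R) : quarticShift t * quarticShift (-t) = 1 := by
  ext i j
  fin_cases i <;> fin_cases j <;>
    simp [quarticShift, Matrix.mul_apply, Fin.sum_univ_five] <;> ring

lemma transvectant_reverse (c : Fin 9 → R) :
    transvectant (reverse c) * quarticReverse = quarticReverse * transvectant c := by
  ext i j
  fin_cases i <;> fin_cases j <;>
    simp [transvectant, normCoeff, reverse, quarticReverse, Matrix.mul_apply, Fin.sum_univ_five,
      Fin.rev]

lemma quartic_reverse (c : Fin 9 → R) :
    quartic (reverse c) = quarticReverse *ᵥ quartic c := by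
  ext i
  fin_cases i <;>
    simp [quartic, normCoeff, reverse, quarticReverse, Matrix.mulVec, dotProduct,
      Fin.sum_univ_five, Fin.rev] <;>
    ring

lemma pairing_quarticReverse (g h : Fin 5 → R) :
    pairing (quarticReverse *ᵥ g) (quarticReverse *ᵥ h) = pairing g h := by
  simp [pairing, quarticReverse, Matrix.mulVec, dotProduct, Fin.sum_univ_five]
  ring

lemma quarticReverse_mul_self :
    (quarticReverse : Matrix (Fin 5) (Fin 5) R) * quarticReverse = 1 := by
  ext i j
  fin_cases i <;> fin_cases j <;>
    simp [quarticReverse, Matrix.mul_apply, Fin.sum_univ_five]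

lemma moment_eq_of_intertwining {c c' : Fin 9 → R} {T : Matrix (Fin 5) (Fin 5) R}
    (hA : transvectant c' * T = T * transvectant c) (hq : quartic c' = T *ᵥ quartic c)
    (hT : ∀ g h, pairing (T *ᵥ g) (T *ᵥ h) = pairing g h) (i : ℕ) : moment i c' = moment i c := by
  have h (i : ℕ) : transvectant c' ^ i * T = T * transvectant c ^ i := by
    induction i with
    | zero => simp
    | succ i ih => rw [pow_succ', mul_assoc, ih, ← mul_assoc, hA, mul_assoc, ← pow_succ']
  rw [moment, hq, Matrix.mulVec_mulVec, h, ← Matrix.mulVec_mulVec, hT, moment]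

lemma traceSq_eq_of_intertwining {c c' : Fin 9 → R} {T U : Matrix (Fin 5) (Fin 5) R}
    (hA : transvectant c' * T = T * transvectant c) (hT : T * U = 1) :
    traceSq c' = traceSq c := by
  have h : transvectant c' = T * transvectant c * U := by
    rw [← hA, mul_assoc, hT, mul_one]
  have hU : U * T = 1 := mul_eq_one_comm.1 hT
  rw [traceSq, h, traceSq, show T * transvectant c * U * (T * transvectant c * U) =
    T * transvectant c * ((U * T) * (transvectant c * U)) by noncomm_ring, hU, one_mul,
    Matrix.mul_assoc, Matrix.trace_mul_comm]
  congr 1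
  rw [← mul_assoc, mul_assoc _ U T, hU, mul_one]

lemma moment_shiftX (i : ℕ) (t : R) (c : Fin 9 → R) : moment i (shiftX t c) = moment i c :=
  moment_eq_of_intertwining (transvectant_shiftX t c) (quartic_shiftX t c)
    (pairing_quarticShift t) i

lemma moment_reverse (i : ℕ) (c : Fin 9 → R) : moment i (reverse c) = moment i c :=
  moment_eq_of_intertwining (transvectant_reverse c) (quartic_reverse c) pairing_quarticReverse i

lemma traceSq_shiftX (t : R) (c : Fin 9 → R) : traceSq (shiftX t c) = traceSq c :=
  traceSq_eq_of_intertwining (transvectant_shiftX t c) (quarticShift_mul_neg t)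

lemma traceSq_reverse (c : Fin 9 → R) : traceSq (reverse c) = traceSq c :=
  traceSq_eq_of_intertwining (transvectant_reverse c) quarticReverse_mul_self

lemma transvectant_smul (s : R) (c : Fin 9 → R) : transvectant (s • c) = s • transvectant c := by
  ext i j
  fin_cases i <;> fin_cases j <;> simp [transvectant, normCoeff] <;> ring

lemma quartic_smul (s : R) (c : Fin 9 → R) : quartic (s • c) = s ^ 2 • quartic c := by
  ext i
  fin_cases i <;> simp [quartic, normCoeff] <;> ring

lemma pairing_smul (s t : R) (g h : Fin 5 → R) :
    pairing (s • g) (t • h) = s * t * pairing g h := by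
  simp [pairing]
  ring

lemma moment_smul (i : ℕ) (s : R) (c : Fin 9 → R) :
    moment i (s • c) = s ^ (4 + i) * moment i c := by
  rw [moment, transvectant_smul, quartic_smul, smul_pow, Matrix.smul_mulVec, Matrix.mulVec_smul,
    smul_smul, pairing_smul, moment]
  ring

lemma traceSq_smul (s : R) (c : Fin 9 → R) : traceSq (s • c) = s ^ 2 * traceSq c := by
  rw [traceSq, transvectant_smul, Matrix.smul_mul, Matrix.mul_smul, Matrix.trace_smul,
    Matrix.trace_smul, traceSq, smul_eq_mul, smul_eq_mul]
  ring

/-- The coefficients of the octavics that are even in `X`. -/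
def evenOctavic (c₀ c₂ c₄ c₆ c₈ : R) : Fin 9 → R := ![c₀, 0, c₂, 0, c₄, 0, c₆, 0, c₈]

/-- The trace of the transvectant operator of an even octavic on even quartics. -/
def evenTrace (c₄ : R) : R := 32 * c₄

/-- The second coefficient of the characteristic polynomial of the transvectant operator of an even
octavic on even quartics. -/
def evenMinor (c₀ c₂ c₄ c₆ c₈ : R) : R := 208 * c₄ ^ 2 - 1200 * c₂ * c₆ - 78400 * c₀ * c₈

/-- The determinant of the transvectant operator of an even octavic on even quartics. -/
def evenDet (c₀ c₂ c₄ c₆ c₈ : R) : R :=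
  384 * c₄ ^ 3 - 4800 * c₂ * c₄ * c₆ + 168000 * (c₂ ^ 2 * c₈ + c₀ * c₆ ^ 2)
    - 1881600 * c₀ * c₄ * c₈

lemma transvectant_evenOctavic_mulVec (c₀ c₂ c₄ c₆ c₈ x y z : R) :
    transvectant (evenOctavic c₀ c₂ c₄ c₆ c₈) *ᵥ ![x, 0, y, 0, z] =
      ![4 * c₄ * x + 10 * c₂ * y + 280 * c₀ * z, 0,
        60 * c₆ * x + 24 * c₄ * y + 60 * c₂ * z, 0,
        280 * c₈ * x + 10 * c₆ * y + 4 * c₄ * z] := by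
  ext i
  fin_cases i <;>
    simp [transvectant, normCoeff, evenOctavic, Matrix.mulVec, dotProduct, Fin.sum_univ_five]
  ring

lemma transvectant_evenOctavic_pow_succ_mulVec (c₀ c₂ c₄ c₆ c₈ : R) {v : Fin 5 → R} {i : ℕ}
    {x y z : R} (h : transvectant (evenOctavic c₀ c₂ c₄ c₆ c₈) ^ i *ᵥ v = ![x, 0, y, 0, z]) :
    transvectant (evenOctavic c₀ c₂ c₄ c₆ c₈) ^ (i + 1) *ᵥ v =
      ![4 * c₄ * x + 10 * c₂ * y + 280 * c₀ * z, 0,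
        60 * c₆ * x + 24 * c₄ * y + 60 * c₂ * z, 0,
        280 * c₈ * x + 10 * c₆ * y + 4 * c₄ * z] := by
  rw [pow_succ', ← Matrix.mulVec_mulVec, h, transvectant_evenOctavic_mulVec]

/-- For an even octavic the covariant quartic is even, so the Cayley–Hamilton theorem for the
operator on the three-dimensional space of even quartics gives a recurrence of length three for the
moments. -/
lemma moment_evenOctavic (c₀ c₂ c₄ c₆ c₈ : R) (i : ℕ) :
    moment (i + 3) (evenOctavic c₀ c₂ c₄ c₆ c₈) =
      evenTrace c₄ * moment (i + 2) (evenOctavic c₀ c₂ c₄ c₆ c₈)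
        - evenMinor c₀ c₂ c₄ c₆ c₈ * moment (i + 1) (evenOctavic c₀ c₂ c₄ c₆ c₈)
        + evenDet c₀ c₂ c₄ c₆ c₈ * moment i (evenOctavic c₀ c₂ c₄ c₆ c₈) := by
  set c := evenOctavic c₀ c₂ c₄ c₆ c₈ with hc
  have heven : ∃ x y z, transvectant c ^ i *ᵥ quartic c = ![x, 0, y, 0, z] := by
    induction i with
    | zero =>
      refine ⟨quartic c 0, quartic c 2, quartic c 4, ?_⟩
      ext i
      fin_cases i <;> simp [quartic, normCoeff, hc, evenOctavic]
    | succ i ih =>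
      obtain ⟨x, y, z, h⟩ := ih
      exact ⟨_, _, _, transvectant_evenOctavic_pow_succ_mulVec c₀ c₂ c₄ c₆ c₈ h⟩
  obtain ⟨x, y, z, h⟩ := heven
  have h1 := transvectant_evenOctavic_pow_succ_mulVec c₀ c₂ c₄ c₆ c₈ h
  have h2 := transvectant_evenOctavic_pow_succ_mulVec c₀ c₂ c₄ c₆ c₈ h1
  have h3 := transvectant_evenOctavic_pow_succ_mulVec c₀ c₂ c₄ c₆ c₈ h2
  rw [← hc] at h1 h2 h3
  rw [moment, moment, moment, moment, h, h1, show i + 2 = i + 1 + 1 from rfl, h2,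
    show i + 3 = i + 1 + 1 + 1 from rfl, h3]
  generalize quartic c = q
  simp [pairing, evenTrace, evenMinor, evenDet]
  ring

lemma traceSq_evenOctavic (c₀ c₂ c₄ c₆ c₈ : R) :
    traceSq (evenOctavic c₀ c₂ c₄ c₆ c₈) =
      1536 * c₄ ^ 2 + 3200 * c₂ * c₆ - 2 * evenMinor c₀ c₂ c₄ c₆ c₈ := by
  simp [traceSq, transvectant, normCoeff, evenOctavic, Matrix.trace, Fin.sum_univ_five, evenMinor]
  ring

/-- The determinant of the linear system for the coefficients of the recurrence of the moments. -/
def hankel (c : Fin 9 → R) : R :=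
  moment 0 c * (moment 2 c * moment 4 c - moment 3 c ^ 2)
    - moment 1 c * (moment 1 c * moment 4 c - moment 3 c * moment 2 c)
    + moment 2 c * (moment 1 c * moment 3 c - moment 2 c ^ 2)

lemma hankel_map (φ : R →+* S) (c : Fin 9 → R) : φ (hankel c) = hankel (φ ∘ c) := by
  simp only [hankel, map_add, map_sub, map_mul, map_pow, moment_map]

/-- The linear system for the coefficients of the recurrence is nonsingular for the normal equation
with `a₁ = a₂ = 0`, `a₃ = 1`, hence for the generic one. -/
lemma hankel_ne_zero [IsDomain R] [CharZero R] : hankel (evenOctavic (1 : R) 0 0 1 1) ≠ 0 := by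
  set c := evenOctavic (1 : R) 0 0 1 1 with hc
  have hq : quartic c = ![2800, 0, 78400, 0, 0] := by
    ext i
    fin_cases i <;> simp [hc, quartic, normCoeff, evenOctavic] <;> norm_num
  have hs (i : ℕ) {x y z : R} (h : transvectant c ^ i *ᵥ quartic c = ![x, 0, y, 0, z]) :
      moment i c = 33600 * z + 156800 * y ∧
      transvectant c ^ (i + 1) *ᵥ quartic c = ![280 * z, 0, 60 * x, 0, 280 * x + 10 * y] := by
    constructor
    · rw [moment, h, hq]
      simp [pairing]
      ring
    · rw [hc] at h ⊢
      rw [transvectant_evenOctavic_pow_succ_mulVec _ _ _ _ _ h]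
      simp
  obtain ⟨m0, h1⟩ := hs 0 (by rw [pow_zero, Matrix.one_mulVec, hq])
  obtain ⟨m1, h2⟩ := hs _ h1
  obtain ⟨m2, h3⟩ := hs _ h2
  obtain ⟨m3, h4⟩ := hs _ h3
  obtain ⟨m4, -⟩ := hs _ h4
  have e : hankel c = -838952992100856574771200000000000000000000 := by
    norm_num at m0 m1 m2 m3 m4
    rw [hankel, m0, m1, m2, m3, m4]
    norm_num
  rw [e]
  norm_num

end

variable {k : Type*} [Field k]

lemma isInvariant_moment (i : ℕ) :
    IsInvariant (4 + i) (moment i X : MvPolynomial (Fin 9) k) := by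
  have h (c : Fin 9 → k) : eval c (moment i X : MvPolynomial (Fin 9) k) = moment i c := by
    rw [moment_map]
    congr 1
    ext i
    simp
  constructor
  · intro s c; rw [h, h, moment_smul]
  · intro t c; rw [h, h, moment_shiftX]
  · intro t c; rw [h, h, shiftZ, moment_reverse, moment_shiftX, moment_reverse]

lemma isInvariant_traceSq : IsInvariant 2 (traceSq X : MvPolynomial (Fin 9) k) := by
  have h (c : Fin 9 → k) : eval c (traceSq X : MvPolynomial (Fin 9) k) = traceSq c := by
    rw [traceSq_map]
    congr 1
    ext i
    simp
  constructor
  · intro s c; rw [h, h, traceSq_smul]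
  · intro t c; rw [h, h, traceSq_shiftX]
  · intro t c; rw [h, h, shiftZ, traceSq_reverse, traceSq_shiftX, traceSq_reverse]

end

/-! ### Automorphisms of hyperelliptic function fields preserve the rational subfield -/

section
open Polynomial
variable {k : Type*} [Field k]

lemma natDegree_coeff_le_natDegree_swap (H : k[X][X]) (i : ℕ) :
    (H.coeff i).natDegree ≤ (Bivariate.swap H).natDegree := by
  obtain ⟨G, rfl⟩ := (Bivariate.swap (R := k)).surjective H
  rw [Bivariate.swap_swap_apply]
  conv_lhs => rw [G.as_sum_range, map_sum]
  simp only [Bivariate.swap_monomial, finsetSum_coeff]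
  refine natDegree_sum_le_of_forall_le _ _ fun j hj => ?_
  rw [mul_comm, coeff_C_mul, coeff_map]
  refine (natDegree_mul_C_le _ _).trans ((natDegree_X_pow_le _).trans ?_)
  exact Nat.lt_succ_iff.1 (Finset.mem_range.1 hj)

section FunctionField

variable {K : Type*} [Field K] [Algebra k K] [Algebra (RatFunc k) K] [IsScalarTower k (RatFunc k) K]

lemma aeval_algebraMap_X (p : k[X]) : aeval (algebraMap (RatFunc k) K RatFunc.X) p =
    algebraMap (RatFunc k) K (algebraMap k[X] (RatFunc k) p) := by
  rw [Polynomial.aeval_algebraMap_apply, ← RatFunc.algebraMap_X,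
    Polynomial.aeval_algebraMap_apply, aeval_X_left_apply]

lemma aevalAeval_algebraMap_X (z : K) (Q : k[X][X]) :
    aevalAeval (algebraMap (RatFunc k) K RatFunc.X) z Q =
      aeval z (Q.map (algebraMap k[X] (RatFunc k))) := by
  induction Q using Polynomial.induction_on' with
  | add p q hp hq => simp only [map_add, Polynomial.map_add, hp, hq]
  | monomial n a =>
    rw [← C_mul_X_pow_eq_monomial, map_mul, map_pow, aevalAeval_C, aevalAeval_Y,
      aeval_algebraMap_X]
    simp

/-- If a primitive polynomial `H` in `k[S][T]` is, up to a factor, the minimal polynomial over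
`k(S)` of `z`, then its degree in `S` is at most that of any relation between `S` and `z`. -/
lemma natDegree_coeff_le_of_relation {z : K} {H : k[X][X]} (hH : H.IsPrimitive)
    (hmin : ∀ G : (RatFunc k)[X], aeval z G = 0 → H.map (algebraMap k[X] (RatFunc k)) ∣ G)
    {Q : k[X][X]} (hQ : Q ≠ 0)
    (hrel : aevalAeval z (algebraMap (RatFunc k) K RatFunc.X) Q = 0) (i : ℕ) :
    (H.coeff i).natDegree ≤ Q.natDegree := by
  rw [← Bivariate.aevalAeval_swap, aevalAeval_algebraMap_X] at hrel
  have h1 : H ∣ Bivariate.swap Q :=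
    (hH.dvd_iff_fraction_map_dvd_fraction_map (RatFunc k)).2 (hmin _ hrel)
  have h2 : Bivariate.swap H ∣ Q := by
    have := map_dvd (Bivariate.swap (R := k)) h1
    rwa [Bivariate.swap_swap_apply] at this
  exact (natDegree_coeff_le_natDegree_swap H i).trans (natDegree_le_of_dvd h2 hQ)

/-- A relation over `k(x)` satisfied by `σ⁻¹ x` is turned by `σ` into one over `k(σ x)` satisfied by
`x`. -/
lemma natDegree_coeff_le_of_algEquiv (σ : K ≃ₐ[k] K) {H : k[X][X]} (hH : H.IsPrimitive)
    (hmin : ∀ G : (RatFunc k)[X], aeval (σ (algebraMap (RatFunc k) K RatFunc.X)) G = 0 →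
      H.map (algebraMap k[X] (RatFunc k)) ∣ G)
    {Q : k[X][X]} (hQ : Q ≠ 0)
    (hrel : aeval (σ.symm (algebraMap (RatFunc k) K RatFunc.X))
      (Q.map (algebraMap k[X] (RatFunc k))) = 0) (i : ℕ) :
    (H.coeff i).natDegree ≤ Q.natDegree := by
  refine natDegree_coeff_le_of_relation hH hmin hQ ?_ i
  set x := algebraMap (RatFunc k) K RatFunc.X
  have h : (σ : K →ₐ[k] K).comp (aevalAeval x (σ.symm x)) = aevalAeval (σ x) x := by
    apply Polynomial.algHom_ext'
    · ext
      simp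
    · simp
  rw [← aevalAeval_algebraMap_X] at hrel
  rw [← h, AlgHom.comp_apply, hrel, map_zero]

end FunctionField

/-- A rational square multiple of a squarefree polynomial that is a polynomial is a polynomial
square multiple. -/
lemma exists_eq_sq_mul_of_squarefree {f D : k[X]} (hf : Squarefree f) {s : RatFunc k}
    (h : algebraMap k[X] (RatFunc k) D = s ^ 2 * algebraMap k[X] (RatFunc k) f) :
    ∃ p : k[X], s = algebraMap k[X] (RatFunc k) p ∧ D = p ^ 2 * f := by
  have hd : algebraMap k[X] (RatFunc k) s.denom ≠ 0 :=
    RatFunc.algebraMap_ne_zero s.denom_ne_zero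
  have e : D * s.denom ^ 2 = s.num ^ 2 * f := by
    apply RatFunc.algebraMap_injective
    rw [map_mul, h, map_mul, map_pow, map_pow]
    nth_rewrite 1 [← RatFunc.num_div_denom s]
    field_simp
  have hdvd : s.denom ^ 2 ∣ f :=
    (s.isCoprime_num_denom.symm.pow (m := 2) (n := 2)).dvd_of_dvd_mul_left ⟨D, by rw [← e]; ring⟩
  have h1 : s.denom = 1 :=
    s.monic_denom.eq_one_of_isUnit (hf _ (by rwa [← sq]))
  refine ⟨s.num, ?_, by simpa [h1] using e⟩
  conv_lhs => rw [← RatFunc.num_div_denom s, h1]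
  simp

lemma exists_integral_multiple (q : (RatFunc k)[X]) :
    ∃ (Q : k[X][X]) (h : RatFunc k), h ≠ 0 ∧ Q.map (algebraMap k[X] (RatFunc k)) = C h * q := by
  obtain ⟨b, hb, h⟩ := IsLocalization.integerNormalization_spec (nonZeroDivisors k[X]) q
  refine ⟨_, algebraMap k[X] (RatFunc k) b,
    RatFunc.algebraMap_ne_zero (nonZeroDivisors.ne_zero hb), h.trans ?_⟩
  rw [← smul_eq_C_mul, algebraMap_smul]

lemma exists_primitive_multiple (q : (RatFunc k)[X]) (hq : q ≠ 0) :
    ∃ (H : k[X][X]) (h : RatFunc k), H.IsPrimitive ∧ h ≠ 0 ∧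
      H.map (algebraMap k[X] (RatFunc k)) = C h * q := by
  classical
  obtain ⟨Q, h, hh, hQ⟩ := exists_integral_multiple q
  have hQ0 : Q ≠ 0 := by
    rintro rfl
    rw [Polynomial.map_zero] at hQ
    exact mul_ne_zero (C_ne_zero.2 hh) hq hQ.symm
  let : NormalizedGCDMonoid k[X] := Classical.choice inferInstance
  have hc : algebraMap k[X] (RatFunc k) Q.content ≠ 0 :=
    RatFunc.algebraMap_ne_zero (content_eq_zero_iff.not.2 hQ0)
  refine ⟨Q.primPart, (algebraMap k[X] (RatFunc k) Q.content)⁻¹ * h, Q.isPrimitive_primPart,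
    mul_ne_zero (inv_ne_zero hc) hh, ?_⟩
  have := congrArg (map (algebraMap k[X] (RatFunc k))) Q.eq_C_content_mul_primPart
  rw [hQ, Polynomial.map_mul, map_C] at this
  rw [C_mul, mul_assoc, this, ← mul_assoc, ← C_mul, inv_mul_cancel₀ hc, C_1, one_mul]

/-- `K = k(x)(y)` with `y ^ 2 = f(x)`, for a squarefree polynomial `f` of degree at least five. -/
structure IsHyperelliptic (K : Type*) [Field K] [Algebra (RatFunc k) K] (f : k[X]) (y : K) :
    Prop where
  squarefree : Squarefree f
  natDegree : 5 ≤ f.natDegree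
  sq : y ^ 2 = algebraMap (RatFunc k) K (algebraMap k[X] (RatFunc k) f)
  span : ∀ w : K, ∃ a b : RatFunc k, w = algebraMap _ K a + algebraMap _ K b * y

namespace IsHyperelliptic

variable {K : Type*} [Field K] [Algebra (RatFunc k) K] {f : k[X]} {y : K}

lemma natDegree_le_of_sq_mul (hK : IsHyperelliptic K f y) {D : k[X]} (hD : D ≠ 0) {s : RatFunc k}
    (h : algebraMap k[X] (RatFunc k) D = s ^ 2 * algebraMap k[X] (RatFunc k) f) :
    5 ≤ D.natDegree := by
  obtain ⟨p, -, hp⟩ := exists_eq_sq_mul_of_squarefree hK.squarefree h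
  exact hK.natDegree.trans (natDegree_le_of_dvd ⟨p ^ 2, by rw [hp]; ring⟩ hD)

lemma root_notMem (hK : IsHyperelliptic K f y) (r : RatFunc k) : algebraMap _ K r ≠ y := by
  rintro rfl
  have hf0 : f ≠ 0 := hK.squarefree.ne_zero
  have h := hK.sq
  rw [← map_pow] at h
  have h := (algebraMap (RatFunc k) K).injective h
  have hr : r ≠ 0 := by
    rintro rfl
    rw [zero_pow two_ne_zero] at h
    exact RatFunc.algebraMap_ne_zero hf0 h.symm
  have := hK.natDegree_le_of_sq_mul (D := 1) (s := r⁻¹) one_ne_zero (by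
    rw [← h, map_one]
    field_simp)
  simp at this

lemma eq_zero_of_add_mul_eq_zero (hK : IsHyperelliptic K f y) {a b : RatFunc k}
    (h : algebraMap _ K a + algebraMap _ K b * y = 0) : a = 0 ∧ b = 0 := by
  have hb : b = 0 := by
    by_contra hb
    refine hK.root_notMem (-a / b) ?_
    have : algebraMap (RatFunc k) K b ≠ 0 := by simpa using hb
    rw [map_div₀, map_neg]
    field_simp
    linear_combination -h
  subst hb
  simpa using h

/-- The polynomial over `k(x)` with the roots `a ± b * y`. -/
noncomputable def quadratic (f : k[X]) (a b : RatFunc k) : (RatFunc k)[X] :=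
  X ^ 2 - C (2 * a) * X + C (a ^ 2 - b ^ 2 * algebraMap k[X] (RatFunc k) f)

lemma natDegree_quadratic (a b : RatFunc k) : (quadratic f a b).natDegree = 2 := by
  unfold quadratic
  compute_degree!

lemma monic_quadratic (a b : RatFunc k) : (quadratic f a b).Monic := by
  unfold quadratic
  monicity!

lemma aeval_quadratic (hK : IsHyperelliptic K f y) (a b : RatFunc k) :
    aeval (algebraMap _ K a + algebraMap _ K b * y) (quadratic f a b) = 0 := by
  simp only [quadratic, map_add, map_sub, map_pow, map_mul, aeval_X, aeval_C, map_ofNat]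
  linear_combination (algebraMap (RatFunc k) K b) ^ 2 * hK.sq

lemma quadratic_dvd (hK : IsHyperelliptic K f y) {a b : RatFunc k} (hb : b ≠ 0) {G : (RatFunc k)[X]}
    (hG : aeval (algebraMap _ K a + algebraMap _ K b * y) G = 0) : quadratic f a b ∣ G := by
  have hq := monic_quadratic (f := f) a b
  have hlt : (G %ₘ quadratic f a b).degree < 2 := by
    have := degree_modByMonic_lt G hq
    rwa [degree_eq_natDegree hq.ne_zero, natDegree_quadratic] at this
  rw [← modByMonic_eq_zero_iff_dvd hq]
  have h0 := aeval_modByMonic_eq_self_of_root (p := G) (hK.aeval_quadratic a b)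
  rw [hG] at h0
  obtain ⟨c, d, e⟩ : ∃ c d, G %ₘ quadratic f a b = C c * X + C d :=
    exists_eq_X_add_C_of_natDegree_le_one (natDegree_le_of_degree_le (Order.le_of_lt_succ hlt))
  rw [e] at h0 ⊢
  simp only [map_add, map_mul, aeval_X, aeval_C] at h0
  have := hK.eq_zero_of_add_mul_eq_zero (a := c * a + d) (b := c * b) (by
    rw [← h0, map_add, map_mul, map_mul]; ring)
  have hc := (mul_eq_zero.1 this.2).resolve_right hb
  have hd := this.1
  rw [hc, zero_mul, zero_add] at hd
  simp [hc, hd]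

variable [Algebra k K] [IsScalarTower k (RatFunc k) K]

/-- Uniqueness of the hyperelliptic structure: an automorphism maps `x` into `k(x)`. Otherwise `x`
and `σ x` generate the function field and satisfy an irreducible relation of degree two in both
variables; its discriminant is a polynomial in `x` of degree at most four that differs from `f` by a
square factor. -/
lemma exists_algEquiv_X_eq [CharZero k] (hK : IsHyperelliptic K f y) (σ : K ≃ₐ[k] K) :
    ∃ r : RatFunc k, σ (algebraMap (RatFunc k) K RatFunc.X) = algebraMap _ K r := by
  obtain ⟨a, b, hz⟩ := hK.span (σ (algebraMap (RatFunc k) K RatFunc.X))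
  by_cases hb : b = 0
  · exact ⟨a, by simpa [hb] using hz⟩
  obtain ⟨a', b', hw⟩ := hK.span (σ.symm (algebraMap (RatFunc k) K RatFunc.X))
  obtain ⟨Q, h', hh', hQ⟩ := exists_integral_multiple (quadratic f a' b')
  obtain ⟨H, h, hH, hh, hHq⟩ := exists_primitive_multiple _ (monic_quadratic (f := f) a b).ne_zero
  have hinj := RatFunc.algebraMap_injective k
  have hQ2 : Q.natDegree = 2 := by
    rw [← natDegree_map_eq_of_injective hinj, hQ, natDegree_C_mul hh', natDegree_quadratic]
  have hdeg := natDegree_coeff_le_of_algEquiv σ hH (Q := Q) (fun G hG => by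
      rw [hz] at hG
      rw [hHq]
      exact (isUnit_C.2 hh.isUnit).mul_left_dvd.2 (hK.quadratic_dvd hb hG))
    (by rintro rfl; simp at hQ2) (by rw [hQ, hw, map_mul, hK.aeval_quadratic, mul_zero])
  rw [hQ2] at hdeg
  have hcoeff (i : ℕ) :
      algebraMap k[X] (RatFunc k) (H.coeff i) = h * (quadratic f a b).coeff i := by
    rw [← coeff_map, hHq, coeff_C_mul]
  have c0 : (quadratic f a b).coeff 0 = a ^ 2 - b ^ 2 * algebraMap k[X] (RatFunc k) f := by
    rw [quadratic, coeff_add, coeff_sub, coeff_C_mul, coeff_X_pow, coeff_X, coeff_C]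
    norm_num
  have c1 : (quadratic f a b).coeff 1 = -(2 * a) := by
    rw [quadratic, coeff_add, coeff_sub, coeff_C_mul, coeff_X_pow, coeff_X, coeff_C]
    norm_num
  have c2 : (quadratic f a b).coeff 2 = 1 := by
    rw [quadratic, coeff_add, coeff_sub, coeff_C_mul, coeff_X_pow, coeff_X, coeff_C]
    norm_num
  have hD : algebraMap k[X] (RatFunc k) (H.coeff 1 ^ 2 - 4 * H.coeff 2 * H.coeff 0) =
      (2 * h * b) ^ 2 * algebraMap k[X] (RatFunc k) f := by
    simp only [map_sub, map_mul, map_pow, hcoeff, c0, c1, c2, map_ofNat]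
    ring
  have hD0 : H.coeff 1 ^ 2 - 4 * H.coeff 2 * H.coeff 0 ≠ 0 := by
    intro h0
    rw [h0, map_zero] at hD
    refine mul_ne_zero (pow_ne_zero _ (mul_ne_zero (mul_ne_zero ?_ hh) hb))
      (RatFunc.algebraMap_ne_zero hK.squarefree.ne_zero) hD.symm
    norm_num
  have h5 := hK.natDegree_le_of_sq_mul hD0 hD
  have h4 : (H.coeff 1 ^ 2 - 4 * H.coeff 2 * H.coeff 0).natDegree ≤ 4 := by
    refine (natDegree_sub_le _ _).trans (max_le ?_ ?_)
    · exact (natDegree_pow_le_of_le 2 (hdeg 1))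
    · refine natDegree_mul_le_of_le (m := 2) (n := 2) ?_ (hdeg 0)
      exact (natDegree_mul_le_of_le (m := 0) (n := 2) (by simp) (hdeg 2))
  omega

end IsHyperelliptic

end

/-! ### Involutions act by traceless Möbius transformations -/

section
variable {k : Type*} [Field k]

section
open Polynomial
variable {K : Type*} [Field K] [Algebra (RatFunc k) K] {f : k[X]} {y : K}
variable [Algebra k K] [IsScalarTower k (RatFunc k) K]

lemma algEquiv_algebraMap_polynomial {σ : K ≃ₐ[k] K} {r : RatFunc k}
    (hr : σ (algebraMap (RatFunc k) K RatFunc.X) = algebraMap _ K r) (p : k[X]) :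
    σ (algebraMap (RatFunc k) K (algebraMap k[X] (RatFunc k) p)) =
      algebraMap (RatFunc k) K (aeval r p) := by
  rw [← aeval_algebraMap_X, ← AlgEquiv.coe_toAlgHom, ← aeval_algHom_apply,
    AlgEquiv.coe_toAlgHom, hr, aeval_algebraMap_apply]

lemma exists_algEquiv_algebraMap_eq {σ : K ≃ₐ[k] K} {r : RatFunc k}
    (hr : σ (algebraMap (RatFunc k) K RatFunc.X) = algebraMap _ K r) (g : RatFunc k) :
    ∃ g', σ (algebraMap (RatFunc k) K g) = algebraMap (RatFunc k) K g' := by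
  refine ⟨aeval r g.num / aeval r g.denom, ?_⟩
  nth_rewrite 1 [← RatFunc.num_div_denom g]
  rw [map_div₀, map_div₀, algEquiv_algebraMap_polynomial hr, algEquiv_algebraMap_polynomial hr,
    map_div₀]

lemma isPrimitive_denom_mul_X_sub_num (r : RatFunc k) :
    (C r.denom * X - C r.num : k[X][X]).IsPrimitive := by
  intro d hd
  rw [C_dvd_iff_dvd_coeff] at hd
  have h0 := hd 0
  have h1 := hd 1
  simp only [coeff_sub, mul_coeff_zero, coeff_X_zero, mul_zero, coeff_C_zero, zero_sub, dvd_neg]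
    at h0
  simp only [coeff_sub, coeff_C_mul, coeff_X_one, mul_one, coeff_C_succ, sub_zero] at h1
  exact r.isCoprime_num_denom.isUnit_of_dvd' h0 h1

/-- An automorphism of `k(x)` that is an involution is given by a fraction of polynomials of degree
at most one: `x` and `σ x` satisfy a relation of degree one in both variables. -/
lemma natDegree_le_one_of_involution {σ : K ≃ₐ[k] K}
    (hσ : ∀ w, σ (σ w) = w) {r : RatFunc k}
    (hr : σ (algebraMap (RatFunc k) K RatFunc.X) = algebraMap _ K r) :
    r.num.natDegree ≤ 1 ∧ r.denom.natDegree ≤ 1 := by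
  set H : k[X][X] := C r.denom * X - C r.num with hH
  have hprim := isPrimitive_denom_mul_X_sub_num r
  rw [← hH] at hprim
  have hd : algebraMap k[X] (RatFunc k) r.denom ≠ 0 := RatFunc.algebraMap_ne_zero r.denom_ne_zero
  have hmap : H.map (algebraMap k[X] (RatFunc k)) =
      C (algebraMap k[X] (RatFunc k) r.denom) * (X - C r) := by
    rw [hH, Polynomial.map_sub, Polynomial.map_mul, map_C, map_C, map_X, mul_sub, ← C_mul]
    congr 2
    nth_rewrite 3 [← RatFunc.num_div_denom r]
    field_simp
  have hsymm : σ.symm (algebraMap (RatFunc k) K RatFunc.X) = algebraMap _ K r := by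
    rw [AlgEquiv.symm_apply_eq, ← hr, hσ]
  have hdeg : H.natDegree ≤ 1 := by
    rw [hH, sub_eq_add_neg, ← C_neg]
    exact natDegree_linear_le
  have key (i : ℕ) := (natDegree_coeff_le_of_algEquiv σ hprim (Q := H) (fun G hG => by
      rw [hr, aeval_algebraMap_apply] at hG
      rw [hmap]
      refine (isUnit_C.2 hd.isUnit).mul_left_dvd.2 (dvd_iff_isRoot.2 ?_)
      simpa using hG) hprim.ne_zero (by
      rw [hsymm, hmap, aeval_algebraMap_apply]
      simp) i).trans hdeg
  have h0 := key 0
  have h1 := key 1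
  simp only [hH, coeff_sub, mul_coeff_zero, coeff_X_zero, mul_zero, coeff_C_zero, zero_sub,
    natDegree_neg] at h0
  simp only [hH, coeff_sub, coeff_C_mul, coeff_X_one, mul_one, coeff_C_succ, sub_zero] at h1
  exact ⟨h0, h1⟩

namespace IsHyperelliptic

/-- An involution that moves `x` acts on it by a traceless Möbius transformation. -/
lemma exists_moebius [CharZero k] (hK : IsHyperelliptic K f y) {σ : K ≃ₐ[k] K}
    (hσ : ∀ w, σ (σ w) = w)
    (hne : σ (algebraMap (RatFunc k) K RatFunc.X) ≠ algebraMap (RatFunc k) K RatFunc.X) :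
    ∃ (α β γ : k) (r : RatFunc k), σ (algebraMap (RatFunc k) K RatFunc.X) = algebraMap _ K r ∧
      algebraMap k[X] (RatFunc k) (C γ * X - C α) ≠ 0 ∧
      r * algebraMap k[X] (RatFunc k) (C γ * X - C α) =
        algebraMap k[X] (RatFunc k) (C α * X + C β) := by
  obtain ⟨r, hr⟩ := hK.exists_algEquiv_X_eq σ
  obtain ⟨hn, hd⟩ := natDegree_le_one_of_involution hσ hr
  obtain ⟨α, β, hp⟩ := exists_eq_X_add_C_of_natDegree_le_one hn
  obtain ⟨γ, δ, hq⟩ := exists_eq_X_add_C_of_natDegree_le_one hd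
  have hq0 : algebraMap k[X] (RatFunc k) (C γ * X + C δ) ≠ 0 := by
    rw [← hq]
    exact RatFunc.algebraMap_ne_zero r.denom_ne_zero
  have hrpq : r * algebraMap k[X] (RatFunc k) (C γ * X + C δ) =
      algebraMap k[X] (RatFunc k) (C α * X + C β) := by
    rw [← hp, ← hq]
    nth_rewrite 1 [← RatFunc.num_div_denom r]
    exact div_mul_cancel₀ _ (by rw [hq]; exact hq0)
  have hσr : σ (algebraMap (RatFunc k) K r) = algebraMap (RatFunc k) K RatFunc.X := by
    rw [← hr, hσ]
  have h1 := congrArg (fun w => σ (algebraMap (RatFunc k) K w)) hrpq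
  simp only [map_mul] at h1
  rw [hσr, algEquiv_algebraMap_polynomial hr, algEquiv_algebraMap_polynomial hr, ← map_mul] at h1
  have h1 := (algebraMap (RatFunc k) K).injective h1
  simp only [map_add, map_mul, aeval_X, aeval_C] at h1
  have h2 : X * (C γ * (C α * X + C β) + C δ * (C γ * X + C δ)) =
      C α * (C α * X + C β) + C β * (C γ * X + C δ) := by
    apply RatFunc.algebraMap_injective
    simp only [map_add, map_mul, RatFunc.algebraMap_C, RatFunc.algebraMap_X,
      RatFunc.algebraMap_eq_C] at h1 hrpq hq0 ⊢
    linear_combination (RatFunc.C γ * RatFunc.X + RatFunc.C δ) * h1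
      + (RatFunc.C α - RatFunc.C γ * RatFunc.X) * hrpq
  have h2 : C (γ * (α + δ)) * X ^ 2 + C ((δ - α) * (α + δ)) * X + C (-(β * (α + δ))) = 0 := by
    simp only [C_mul, C_add, C_sub, C_neg]
    linear_combination h2
  have e2 := congrArg (fun p => coeff p 2) h2
  have e1 := congrArg (fun p => coeff p 1) h2
  have e0 := congrArg (fun p => coeff p 0) h2
  simp only [coeff_add, coeff_C_mul, coeff_X_pow, coeff_X, coeff_C, coeff_zero] at e0 e1 e2
  norm_num at e0 e1 e2
  by_cases htr : α + δ = 0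
  · obtain rfl : δ = -α := by linear_combination htr
    refine ⟨α, β, γ, r, hr, ?_, ?_⟩
    · simpa [sub_eq_add_neg] using hq0
    · simpa [sub_eq_add_neg] using hrpq
  · exfalso
    obtain rfl : γ = 0 := e2.resolve_right htr
    obtain rfl : β = 0 := e0.resolve_right htr
    obtain rfl : δ = α := sub_eq_zero.1 (e1.resolve_right htr)
    apply hne
    rw [hr]
    congr 1
    simp only [map_zero, zero_mul, zero_add, add_zero, map_mul, RatFunc.algebraMap_X] at hrpq hq0
    exact mul_right_cancel₀ hq0 (hrpq.trans (mul_comm _ _))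

/-- An involution that preserves `k(x)` multiplies `y` by an element of `k(x)`. -/
lemma exists_algEquiv_root_eq [CharZero k] (hK : IsHyperelliptic K f y) {σ : K ≃ₐ[k] K}
    (hσ : ∀ w, σ (σ w) = w) {r : RatFunc k}
    (hr : σ (algebraMap (RatFunc k) K RatFunc.X) = algebraMap _ K r) :
    ∃ s : RatFunc k, σ y = algebraMap _ K s * y ∧
      s ^ 2 * algebraMap k[X] (RatFunc k) f = aeval r f := by
  obtain ⟨a, s, hs⟩ := hK.span (σ y)
  have h1 : σ y ^ 2 = algebraMap (RatFunc k) K (aeval r f) := by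
    rw [← map_pow, hK.sq, algEquiv_algebraMap_polynomial hr]
  have h2 := hK.eq_zero_of_add_mul_eq_zero
    (a := a ^ 2 + s ^ 2 * algebraMap k[X] (RatFunc k) f - aeval r f) (b := 2 * a * s) (by
      rw [hs] at h1
      simp only [map_add, map_sub, map_mul, map_pow, map_ofNat]
      linear_combination h1 - (algebraMap (RatFunc k) K s) ^ 2 * hK.sq)
  rcases mul_eq_zero.1 h2.2 with h | rfl
  · have ha : a = 0 := (mul_eq_zero.1 h).resolve_left (by norm_num)
    subst ha
    exact ⟨s, by simpa using hs, by linear_combination h2.1⟩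
  · exfalso
    obtain ⟨g, hg⟩ := exists_algEquiv_algebraMap_eq hr a
    refine hK.root_notMem g ?_
    rw [← hg, ← hσ y, hs]
    simp

end IsHyperelliptic

end

open MvPolynomial in
lemma aeval_substMatrix {L : Type*} [Field L] [Algebra k L] (M : Matrix (Fin 2) (Fin 2) k)
    (p : MvPolynomial (Fin 2) k) (v : Fin 2 → L) :
    aeval v (substMatrix M p) =
      aeval (fun i => algebraMap k L (M i 0) * v 0 + algebraMap k L (M i 1) * v 1) p := by
  have : (aeval v).comp (substMatrix M) = aeval (R := k)
      (fun i => algebraMap k L (M i 0) * v 0 + algebraMap k L (M i 1) * v 1) := by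
    ext1 i
    simp [substMatrix]
  exact DFunLike.congr_fun this p

lemma aeval_octavic {L : Type*} [Field L] [Algebra k L] (c : Fin 9 → k) (v : Fin 2 → L)
    (hv : v 1 ≠ 0) : MvPolynomial.aeval v (octavic c) =
      v 1 ^ 8 * Polynomial.aeval (v 0 / v 1) (affinePoly c) := by
  simp only [octavic, affinePoly, map_sum, map_mul, map_pow, MvPolynomial.aeval_C,
    MvPolynomial.aeval_X, Polynomial.aeval_C, Polynomial.aeval_X, Finset.mul_sum]
  refine Finset.sum_congr rfl fun i _ => ?_
  have : v 1 ^ 8 = v 1 ^ (i : ℕ) * v 1 ^ (8 - (i : ℕ)) := by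
    rw [← pow_add]
    congr 1
    omega
  rw [this, div_pow]
  field_simp

lemma affinePoly_coeff (c : Fin 9 → k) (i : Fin 9) : (affinePoly c).coeff i = c i := by
  simp only [affinePoly, Polynomial.finsetSum_coeff, Polynomial.coeff_C_mul_X_pow]
  rw [Finset.sum_eq_single i (fun j _ hj => if_neg (by omega)) (by simp), if_pos rfl]

lemma affinePoly_injective : Function.Injective (affinePoly (k := k)) := fun c c' h => by
  ext i
  rw [← affinePoly_coeff c, h, affinePoly_coeff]

lemma affinePoly_smul (s : k) (c : Fin 9 → k) :
    affinePoly (s • c) = Polynomial.C s * affinePoly c := by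
  simp only [affinePoly, Finset.mul_sum, Pi.smul_apply, smul_eq_mul, map_mul, mul_assoc]

lemma derivative_affinePoly (c : Fin 9 → k) :
    Polynomial.derivative (affinePoly c) = partialX c := by
  simp [affinePoly, partialX, Fin.sum_univ_succ, map_ofNat Polynomial.C]
  ring

lemma eight_mul_affinePoly (c : Fin 9 → k) :
    8 * affinePoly c = Polynomial.X * partialX c + partialZ c := by
  simp [affinePoly, partialX, partialZ, Fin.sum_univ_succ, map_ofNat Polynomial.C]
  ring

lemma squarefree_affinePoly [IsAlgClosed k] {c : Fin 9 → k} (hc : IsNonsingular c) :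
    Squarefree (affinePoly c) := by
  apply Polynomial.Separable.squarefree
  rw [Polynomial.Separable, derivative_affinePoly,
    Polynomial.isCoprime_iff_aeval_ne_zero_of_isAlgClosed k k]
  intro x
  by_contra! h
  simp only [Polynomial.coe_aeval_eq_eval] at h
  have h8 := congrArg (Polynomial.eval x) (eight_mul_affinePoly c)
  simp only [Polynomial.eval_mul, Polynomial.eval_add, h.1, h.2, mul_zero, zero_add] at h8
  have := hc ![x, 1] fun i => by
    fin_cases i
    · simpa [eval_partialX] using h.2
    · simpa [eval_partialZ] using h8.symm
  simpa using congrFun this 1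

lemma natDegree_affinePoly [CharZero k] {c : Fin 9 → k} (hc : IsNonsingular c) :
    5 ≤ (affinePoly c).natDegree := by
  by_contra! h
  have h7 : c 7 = 0 := by
    rw [← affinePoly_coeff c 7]
    exact Polynomial.coeff_eq_zero_of_natDegree_lt (h.trans (by decide))
  have h8 : c 8 = 0 := by
    rw [← affinePoly_coeff c 8]
    exact Polynomial.coeff_eq_zero_of_natDegree_lt (h.trans (by decide))
  have := hc ![1, 0] fun i => by
    fin_cases i
    · simp [eval_pderiv_zero, h8]
    · simp [eval_pderiv_one, h7]
  simpa using congrFun this 0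

/-- An involution of the function field that moves `x` comes from a traceless matrix `M` that maps
the octavic to the multiple of itself by `(det M) ^ 4`. -/
lemma IsHyperelliptic.exists_matrix [IsAlgClosed k] [CharZero k] {K : Type*} [Field K]
    [Algebra (RatFunc k) K] {y : K} [Algebra k K] [IsScalarTower k (RatFunc k) K] {c : Fin 9 → k}
    (hc : IsNonsingular c) (hK : IsHyperelliptic K (affinePoly c) y) {σ : K ≃ₐ[k] K}
    (hσ : ∀ w, σ (σ w) = w)
    (hne : σ (algebraMap (RatFunc k) K RatFunc.X) ≠ algebraMap (RatFunc k) K RatFunc.X) :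
    ∃ α β γ : k, α ^ 2 + β * γ ≠ 0 ∧
      octavic ((α ^ 2 + β * γ) ^ 4 • c) = substMatrix !![α, β; γ, -α] (octavic c) := by
  obtain ⟨α, β, γ, r, hr, hl, hrl⟩ := hK.exists_moebius hσ hne
  obtain ⟨s, hs, hsf⟩ := hK.exists_algEquiv_root_eq hσ hr
  set l := algebraMap (Polynomial k) (RatFunc k)
    (Polynomial.C γ * Polynomial.X - Polynomial.C α) with hldef
  have hl' : l = RatFunc.C γ * RatFunc.X - RatFunc.C α := by simp [hldef]
  have hrl' : r * l = RatFunc.C α * RatFunc.X + RatFunc.C β := by simpa using hrl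
  have hσl : σ (algebraMap (RatFunc k) K l) =
      algebraMap (RatFunc k) K (RatFunc.C γ * r - RatFunc.C α) := by
    rw [hldef, algEquiv_algebraMap_polynomial hr]
    simp [RatFunc.algebraMap_eq_C]
  -- `(γ x - α)` times its conjugate is the constant `α ^ 2 + β * γ`.
  have hnorm : (RatFunc.C γ * r - RatFunc.C α) * l = RatFunc.C (α ^ 2 + β * γ) := by
    simp only [map_add, map_mul, map_pow]
    linear_combination (RatFunc.C γ) * hrl' - RatFunc.C α * hl'
  have he : α ^ 2 + β * γ ≠ 0 := by
    intro h0
    rw [h0, map_zero] at hnorm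
    have h1 := (mul_eq_zero.1 hnorm).resolve_right hl
    rw [h1, map_zero] at hσl
    exact hl (by simpa using hσl)
  have hdet : (!![α, β; γ, -α]).det ≠ 0 := by
    rw [Matrix.det_fin_two_of]
    contrapose! he
    linear_combination -he
  obtain ⟨_, _, hM⟩ := scalesInvariants _ hdet
  obtain ⟨c', hc', -⟩ := hM c
  have hns : IsNonsingular c' := hc.of_substMatrix hdet hc'
  have hX := congrArg (MvPolynomial.aeval ![(RatFunc.X : RatFunc k), 1]) hc'
  rw [aeval_substMatrix, aeval_octavic _ _ (by simp), aeval_octavic _ _ (by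
    simpa [RatFunc.algebraMap_eq_C, hl', sub_eq_add_neg] using hl)] at hX
  have hX : algebraMap (Polynomial k) (RatFunc k) (affinePoly c') =
      (s * l ^ 4) ^ 2 * algebraMap (Polynomial k) (RatFunc k) (affinePoly c) := by
    have e1 : Polynomial.aeval (RatFunc.X : RatFunc k) (affinePoly c') =
        algebraMap (Polynomial k) (RatFunc k) (affinePoly c') := by
      rw [← RatFunc.algebraMap_X, Polynomial.aeval_algebraMap_apply, Polynomial.aeval_X_left_apply]
    have e2 : r = (RatFunc.C α * RatFunc.X + RatFunc.C β) / l := by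
      rw [← hrl', mul_div_cancel_right₀ _ hl]
    simp only [Matrix.cons_val_zero, Matrix.cons_val_one, Matrix.of_apply, Matrix.cons_val',
      Matrix.cons_val_fin_one, mul_one, one_pow, one_mul, div_one, e1, RatFunc.algebraMap_eq_C,
      map_neg, ← sub_eq_add_neg, ← hl'] at hX
    rw [hX, ← e2, ← hsf]
    ring
  obtain ⟨p, hp, hpf⟩ := exists_eq_sq_mul_of_squarefree hK.squarefree hX
  have hpu : IsUnit p := squarefree_affinePoly hns p ⟨affinePoly c, by rw [hpf]; ring⟩
  obtain ⟨w, -, rfl⟩ := Polynomial.isUnit_iff.1 hpu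
  have hcc : c' = w ^ 2 • c := by
    apply affinePoly_injective
    rw [hpf, affinePoly_smul, map_pow]
  have hw : w ^ 2 = (α ^ 2 + β * γ) ^ 4 := by
    have hy0 : y ≠ 0 := fun h => hK.root_notMem 0 (by rw [h, map_zero])
    have hss : σ (algebraMap _ K s) * algebraMap _ K s = 1 := by
      have := hσ y
      rw [hs, map_mul, hs, ← mul_assoc] at this
      exact mul_right_cancel₀ hy0 (this.trans (one_mul y).symm)
    have h1 := congrArg (fun g => σ (algebraMap (RatFunc k) K g) * algebraMap (RatFunc k) K g) hp
    simp only [map_mul, map_pow, hσl] at h1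
    rw [algEquiv_algebraMap_polynomial hr, Polynomial.aeval_C] at h1
    have hnorm' := congrArg (algebraMap (RatFunc k) K) hnorm
    rw [map_mul] at hnorm'
    have h2 : algebraMap (RatFunc k) K (RatFunc.C (α ^ 2 + β * γ)) ^ 4 =
        algebraMap (RatFunc k) K (RatFunc.C w) ^ 2 := by
      rw [← hnorm', pow_two (algebraMap (RatFunc k) K (RatFunc.C w))]
      simp only [RatFunc.algebraMap_C, RatFunc.algebraMap_eq_C] at h1
      rw [← h1]
      linear_combination -(algebraMap (RatFunc k) K (RatFunc.C γ * r - RatFunc.C α) ^ 4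
        * algebraMap (RatFunc k) K l ^ 4) * hss
    rw [← map_pow, ← map_pow, ← map_pow, ← map_pow] at h2
    exact (RatFunc.C_injective ((algebraMap (RatFunc k) K).injective h2)).symm
  exact ⟨α, β, γ, he, by rw [← hw, ← hcc, hc']⟩
end

/-! ### Curves with an extra involution are the curves with a normal equation -/

section
variable {k : Type*} [Field k]

lemma exists_eq_of_add_of_mul_root (c : Fin 9 → k) (w : CurveField c) :
    ∃ a b : RatFunc k, w = AdjoinRoot.of _ a + AdjoinRoot.of _ b * AdjoinRoot.root _ := by
  set g : Polynomial (RatFunc k) := Polynomial.X ^ 2 -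
    Polynomial.C (algebraMap (Polynomial k) (RatFunc k) (affinePoly c)) with hg
  have hmonic : g.Monic := Polynomial.monic_X_pow_sub_C _ two_ne_zero
  obtain ⟨p, rfl⟩ := AdjoinRoot.mk_surjective w
  have hlt : (p %ₘ g).degree < 2 := by
    have := Polynomial.degree_modByMonic_lt p hmonic
    rwa [hg, Polynomial.degree_X_pow_sub_C two_pos] at this
  obtain ⟨b, a, e⟩ := Polynomial.exists_eq_X_add_C_of_natDegree_le_one
    (Polynomial.natDegree_le_of_degree_le (Order.le_of_lt_succ hlt))
  refine ⟨a, b, ?_⟩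
  have h : AdjoinRoot.mk g p = AdjoinRoot.mk g (p %ₘ g) := by
    rw [AdjoinRoot.mk_eq_mk]
    exact ⟨p /ₘ g, by linear_combination -Polynomial.modByMonic_add_div p g⟩
  rw [h, e]
  simp only [map_add, map_mul, AdjoinRoot.mk_C, AdjoinRoot.mk_X]
  exact add_comm _ _

lemma irreducible_curve [IsAlgClosed k] [CharZero k] {c : Fin 9 → k} (hc : IsNonsingular c) :
    Irreducible (Polynomial.X ^ 2 -
      Polynomial.C (algebraMap (Polynomial k) (RatFunc k) (affinePoly c))) := by
  refine X_pow_sub_C_irreducible_of_prime Nat.prime_two fun b hb => ?_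
  have hf := squarefree_affinePoly hc
  have hb0 : b ≠ 0 := by
    rintro rfl
    rw [zero_pow two_ne_zero] at hb
    exact RatFunc.algebraMap_ne_zero hf.ne_zero hb.symm
  obtain ⟨p, -, hp⟩ := exists_eq_sq_mul_of_squarefree (D := 1) (s := b⁻¹) hf (by
    rw [← hb, map_one]
    field_simp)
  have hu : IsUnit (affinePoly c) := .of_mul_eq_one (p ^ 2) (by rw [hp]; ring)
  have := natDegree_affinePoly hc
  rw [Polynomial.natDegree_eq_zero_of_isUnit hu] at this
  omega

lemma isHyperelliptic_curveField [IsAlgClosed k] [CharZero k] {c : Fin 9 → k}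
    (hc : IsNonsingular c) [Fact (Irreducible (Polynomial.X ^ 2 -
      Polynomial.C (algebraMap (Polynomial k) (RatFunc k) (affinePoly c))))] :
    IsHyperelliptic (CurveField c) (affinePoly c) (AdjoinRoot.root _) where
  squarefree := squarefree_affinePoly hc
  natDegree := natDegree_affinePoly hc
  sq := by
    have := AdjoinRoot.eval₂_root (Polynomial.X ^ 2 -
      Polynomial.C (algebraMap (Polynomial k) (RatFunc k) (affinePoly c)))
    simpa [sub_eq_zero] using this
  span := exists_eq_of_add_of_mul_root c

/-- A non-hyperelliptic involution moves the coordinate `x`. -/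
lemma exists_matrix_of_hasExtraInvolution [IsAlgClosed k] [CharZero k] {c : Fin 9 → k}
    (hc : IsNonsingular c) (h : HasExtraInvolution c) :
    ∃ α β γ : k, α ^ 2 + β * γ ≠ 0 ∧
      octavic ((α ^ 2 + β * γ) ^ 4 • c) = substMatrix !![α, β; γ, -α] (octavic c) := by
  obtain ⟨σ, hord, hσh⟩ := h
  have : Fact (Irreducible (Polynomial.X ^ 2 -
    Polynomial.C (algebraMap (Polynomial k) (RatFunc k) (affinePoly c)))) := ⟨irreducible_curve hc⟩
  have hK := isHyperelliptic_curveField hc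
  have hσ (w : CurveField c) : σ (σ w) = w := by
    have : σ ^ 2 = 1 := by
      have := pow_orderOf_eq_one σ
      rwa [hord] at this
    exact DFunLike.congr_fun ((pow_two σ).symm.trans this) w
  refine hK.exists_matrix hc hσ fun hx => hσh ?_
  have hfix (g : RatFunc k) : σ (algebraMap (RatFunc k) (CurveField c) g) = algebraMap _ _ g := by
    have hp (p : Polynomial k) : σ (algebraMap (RatFunc k) (CurveField c)
        (algebraMap (Polynomial k) (RatFunc k) p)) = algebraMap (RatFunc k) (CurveField c)
        (algebraMap (Polynomial k) (RatFunc k) p) := by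
      rw [algEquiv_algebraMap_polynomial hx, ← aeval_algebraMap_X,
        Polynomial.aeval_algebraMap_apply]
    rw [← RatFunc.num_div_denom g, map_div₀, map_div₀, hp, hp]
  obtain ⟨s, hs, hsf⟩ := hK.exists_algEquiv_root_eq hσ hx
  have hs1 : (s - 1) * (s + 1) = 0 := by
    have e : Polynomial.aeval (RatFunc.X : RatFunc k) (affinePoly c) =
        algebraMap (Polynomial k) (RatFunc k) (affinePoly c) := by
      rw [← RatFunc.algebraMap_X, Polynomial.aeval_algebraMap_apply, Polynomial.aeval_X_left_apply]
    rw [e] at hsf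
    refine (mul_eq_zero.1 ?_).resolve_right
      (RatFunc.algebraMap_ne_zero (squarefree_affinePoly hc).ne_zero)
    linear_combination hsf
  rcases mul_eq_zero.1 hs1 with h1 | h1
  · exfalso
    obtain rfl : s = 1 := by linear_combination h1
    have : σ = 1 := by
      ext w
      obtain ⟨a, b, rfl⟩ := hK.span w
      rw [map_add, map_mul, hfix, hfix, hs, map_one, one_mul]
      rfl
    rw [this, orderOf_one] at hord
    norm_num at hord
  · obtain rfl : s = -1 := by linear_combination h1
    exact ⟨hfix, by rw [hs, map_neg, map_one, neg_one_mul]⟩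

/-- Diagonalization of a traceless matrix with nonzero determinant. -/
lemma exists_diagonalization [IsAlgClosed k] [CharZero k] {α β γ : k} (h : α ^ 2 + β * γ ≠ 0) :
    ∃ (ε : k) (N : Matrix (Fin 2) (Fin 2) k), ε ^ 2 = α ^ 2 + β * γ ∧ N.det ≠ 0 ∧
      !![α, β; γ, -α] * N = N * !![ε, 0; 0, -ε] := by
  obtain ⟨ε, hε⟩ := IsAlgClosed.exists_pow_nat_eq (α ^ 2 + β * γ) (n := 2) (by norm_num)
  have hε0 : ε ≠ 0 := by
    rintro rfl
    exact h (by rw [← hε]; ring)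
  by_cases hγ : γ = 0
  · by_cases hβ : β = 0
    · subst hγ hβ
      refine ⟨α, 1, by ring, by simp, ?_⟩
      rw [one_mul, mul_one]
    · refine ⟨ε, !![β, β; ε - α, -ε - α], hε, ?_, ?_⟩
      · rw [Matrix.det_fin_two_of]
        have : β * (-ε - α) - β * (ε - α) = -2 * (β * ε) := by ring
        rw [this]
        exact mul_ne_zero (by norm_num) (mul_ne_zero hβ hε0)
      · subst hγ
        ext i j
        fin_cases i <;> fin_cases j <;> simp [Matrix.mul_apply, Fin.sum_univ_two] <;>
          first | ring1 | linear_combination -hε | linear_combination hε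
  · refine ⟨ε, !![α + ε, α - ε; γ, γ], hε, ?_, ?_⟩
    · rw [Matrix.det_fin_two_of]
      have : (α + ε) * γ - (α - ε) * γ = 2 * (ε * γ) := by ring
      rw [this]
      exact mul_ne_zero (by norm_num) (mul_ne_zero hε0 hγ)
    · ext i j
      fin_cases i <;> fin_cases j <;> simp [Matrix.mul_apply, Fin.sum_univ_two] <;>
        first | ring1 | linear_combination -hε

lemma octavic_smul (s : k) (c : Fin 9 → k) : octavic (s • c) = MvPolynomial.C s * octavic c := by
  simp only [octavic, Finset.mul_sum, Pi.smul_apply, smul_eq_mul, map_mul, mul_assoc]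

/-- Coordinates that diagonalize the involution make the octavic even. -/
lemma exists_even_of_hasExtraInvolution [IsAlgClosed k] [CharZero k] {c : Fin 9 → k}
    (hc : IsNonsingular c) (h : HasExtraInvolution c) :
    ∃ (N : Matrix (Fin 2) (Fin 2) k) (d : Fin 9 → k), N.det ≠ 0 ∧
      octavic d = substMatrix N (octavic c) ∧ ∀ i : Fin 9, Odd (i : ℕ) → d i = 0 := by
  obtain ⟨α, β, γ, he, hM⟩ := exists_matrix_of_hasExtraInvolution hc h
  obtain ⟨ε, N, hε, hN, hMN⟩ := exists_diagonalization he
  have hε0 : ε ≠ 0 := by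
    rintro rfl
    exact he (by rw [← hε]; ring)
  obtain ⟨_, _, H⟩ := scalesInvariants N hN
  obtain ⟨d, hd, -⟩ := H c
  refine ⟨N, d, hN, hd, fun i hi => ?_⟩
  have hinv : (fun i : Fin 9 => ε ^ (i : ℕ) * (-ε) ^ (8 - (i : ℕ)) * d i) = ε ^ 8 • d := by
    apply octavic_injective
    rw [octavic_diagonal, hd, ← substMatrix_mul, ← hMN, substMatrix_mul, ← hM, octavic_smul,
      octavic_smul, map_mul, hd, MvPolynomial.algHom_C, ← hε, ← pow_mul,
      MvPolynomial.algebraMap_eq]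
  have := congrFun hinv i
  have hi' : Odd (8 - (i : ℕ)) := by
    obtain ⟨m, hm⟩ := hi
    exact ⟨3 - m, by omega⟩
  have hp : ε ^ (i : ℕ) * ε ^ (8 - (i : ℕ)) = ε ^ 8 := by
    rw [← pow_add]
    congr 1
    omega
  rw [hi'.neg_pow, Pi.smul_apply, smul_eq_mul] at this
  have h2 : 2 * (ε ^ 8 * d i) = 0 := by linear_combination -this - d i * hp
  exact (mul_eq_zero.1 ((mul_eq_zero.1 h2).resolve_left two_ne_zero)).resolve_left
    (pow_ne_zero _ hε0)

/-- The extreme coefficients of a nonsingular even octavic can be scaled to `1`. -/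
lemma exists_diagonal_eq_evenOctavic [IsAlgClosed k] {d : Fin 9 → k} (hdns : IsNonsingular d)
    (hodd : ∀ i : Fin 9, Odd (i : ℕ) → d i = 0) :
    ∃ (s t : k) (a : Fin 3 → k), s ≠ 0 ∧ t ≠ 0 ∧
      octavic (evenOctavic 1 (a 0) (a 1) (a 2) 1) = substMatrix !![s, 0; 0, t] (octavic d) := by
  have hd0 : d 0 ≠ 0 := by
    intro h0
    have := hdns ![0, 1] fun i => by
      fin_cases i
      · simp [eval_pderiv_zero, hodd 1 (by decide)]
      · simp [eval_pderiv_one, h0]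
    simpa using congrFun this 1
  have hd8 : d 8 ≠ 0 := by
    intro h0
    have := hdns ![1, 0] fun i => by
      fin_cases i
      · simp [eval_pderiv_zero, h0]
      · simp [eval_pderiv_one, hodd 7 (by decide)]
    simpa using congrFun this 0
  obtain ⟨s, hs⟩ := IsAlgClosed.exists_pow_nat_eq (d 8)⁻¹ (n := 8) (by norm_num)
  obtain ⟨t, ht⟩ := IsAlgClosed.exists_pow_nat_eq (d 0)⁻¹ (n := 8) (by norm_num)
  have hs0 : s ≠ 0 := by
    rintro rfl
    exact inv_ne_zero hd8 (by rw [← hs]; simp)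
  have ht0 : t ≠ 0 := by
    rintro rfl
    exact inv_ne_zero hd0 (by rw [← ht]; simp)
  refine ⟨s, t, ![s ^ 2 * t ^ 6 * d 2, s ^ 4 * t ^ 4 * d 4, s ^ 6 * t ^ 2 * d 6], hs0, ht0, ?_⟩
  rw [← octavic_diagonal]
  congr 1
  ext i
  fin_cases i
  · simp [evenOctavic, ht, hd0]
  · simp [evenOctavic, hodd 1 (by decide)]
  · simp [evenOctavic]
  · simp [evenOctavic, hodd 3 (by decide)]
  · simp [evenOctavic]
  · simp [evenOctavic, hodd 5 (by decide)]
  · simp [evenOctavic]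
  · simp [evenOctavic, hodd 7 (by decide)]
  · simp [evenOctavic, hs, hd8]

/-- Every curve with an extra involution has a normal equation. -/
lemma exists_equivalent_evenOctavic [IsAlgClosed k] [CharZero k] (c : Octavics k)
    (h : HasExtraInvolution c.1) :
    ∃ (a : Fin 3 → k) (ha : IsNonsingular (evenOctavic 1 (a 0) (a 1) (a 2) 1)),
      Equivalent c ⟨evenOctavic 1 (a 0) (a 1) (a 2) 1, ha⟩ := by
  obtain ⟨N, d, hN, hd, hodd⟩ := exists_even_of_hasExtraInvolution c.2 h
  obtain ⟨s, t, a, hs, ht, ha⟩ := exists_diagonal_eq_evenOctavic (c.2.of_substMatrix hN hd) hodd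
  rw [hd, ← substMatrix_mul] at ha
  have hND : (N * !![s, 0; 0, t]).det ≠ 0 := by
    rw [Matrix.det_mul, Matrix.det_fin_two_of]
    exact mul_ne_zero hN (by simpa using ⟨hs, ht⟩)
  exact ⟨a, c.2.of_substMatrix hND ha, Matrix.GeneralLinearGroup.mkOfDetNeZero _ hND, ha⟩

/-- The `k`-automorphism `x ↦ -x` of `k(x)`. -/
noncomputable def negX (k : Type*) [Field k] : RatFunc k ≃ₐ[k] RatFunc k :=
  IsFractionRing.algEquivOfAlgEquiv Polynomial.algEquivAevalNegX

lemma negX_algebraMap (p : Polynomial k) : negX k (algebraMap (Polynomial k) (RatFunc k) p) =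
    algebraMap (Polynomial k) (RatFunc k) (p.comp (-Polynomial.X)) := by
  rw [negX, IsFractionRing.algEquivOfAlgEquiv_algebraMap, Polynomial.algEquivAevalNegX_apply,
    Polynomial.comp_eq_aeval]

lemma negX_negX (g : RatFunc k) : negX k (negX k g) = g := by
  rw [← RatFunc.num_div_denom g, map_div₀, map_div₀]
  simp only [negX_algebraMap, Polynomial.comp_assoc]
  simp

lemma hasExtraInvolution_evenOctavic [CharZero k] (c₀ c₂ c₄ c₆ c₈ : k) :
    HasExtraInvolution (evenOctavic c₀ c₂ c₄ c₆ c₈) := by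
  set c := evenOctavic c₀ c₂ c₄ c₆ c₈ with hc
  set g : Polynomial (RatFunc k) := Polynomial.X ^ 2 -
    Polynomial.C (algebraMap (Polynomial k) (RatFunc k) (affinePoly c)) with hg
  have hf : negX k (algebraMap (Polynomial k) (RatFunc k) (affinePoly c)) =
      algebraMap (Polynomial k) (RatFunc k) (affinePoly c) := by
    rw [negX_algebraMap]
    congr 1
    simp [affinePoly, Fin.sum_univ_succ, hc, evenOctavic, Polynomial.comp]
    ring
  have hgm : g.map (negX k : RatFunc k →+* RatFunc k) = g := by
    simp [hg, Polynomial.map_sub, hf]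
  let σ : CurveAut c := AdjoinRoot.mapAlgEquiv (negX k) g g (by rw [hgm])
  have hof (r : RatFunc k) : σ (AdjoinRoot.of g r) = AdjoinRoot.of g (negX k r) := by
    simp [σ]
  have hroot : σ (AdjoinRoot.root g) = AdjoinRoot.root g := by
    simp [σ]
  have hX : σ (AdjoinRoot.of g RatFunc.X) ≠ AdjoinRoot.of g RatFunc.X := by
    have hg0 : g.degree ≠ 0 := by
      rw [hg, Polynomial.degree_X_pow_sub_C two_pos]
      norm_num
    rw [hof, ← RatFunc.algebraMap_X, negX_algebraMap]
    refine fun h => ?_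
    have h := RatFunc.algebraMap_injective k (AdjoinRoot.of.injective_of_degree_ne_zero hg0 h)
    have := congrArg (fun p => Polynomial.coeff p 1) h
    rw [Polynomial.X_comp, Polynomial.coeff_neg, Polynomial.coeff_X_one] at this
    exact two_ne_zero (α := k) (by linear_combination -this)
  refine ⟨σ, orderOf_eq_prime ?_ ?_, fun h => hX (h.1 _)⟩
  · rw [pow_two]
    ext w
    obtain ⟨a, b, h⟩ := exists_eq_of_add_of_mul_root c w
    have h : w = AdjoinRoot.of g a + AdjoinRoot.of g b * AdjoinRoot.root g := h
    rw [AlgEquiv.mul_apply, AlgEquiv.one_apply, h, map_add, map_mul, hof, hof, hroot, map_add,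
      map_mul, hof, hof, hroot, negX_negX, negX_negX]
  · intro h
    rw [h] at hX
    exact hX rfl
end

/-! ### Pull-back of regular functions to the space of normal equations -/

section
open MvPolynomial
variable {k : Type*} [Field k]

/-- The coefficients of the octavic of the normal equation with parameters `a`. -/
abbrev normalOctavic {R : Type*} [CommRing R] (a : Fin 3 → R) : Fin 9 → R :=
  evenOctavic 1 (a 0) (a 1) (a 2) 1

lemma normalOctavic_map {R S : Type*} [CommRing R] [CommRing S] (φ : R →+* S) (a : Fin 3 → R) :
    φ ∘ normalOctavic a = normalOctavic (φ ∘ a) := by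
  ext i
  fin_cases i <;> simp [evenOctavic]

/-- Restriction of polynomial functions of octavics to the family of normal equations. -/
noncomputable def toNormal (k : Type*) [Field k] :
    MvPolynomial (Fin 9) k →ₐ[k] MvPolynomial (Fin 3) k :=
  aeval (normalOctavic X)

lemma eval_toNormal (a : Fin 3 → k) (P : MvPolynomial (Fin 9) k) :
    eval a (toNormal k P) = eval (normalOctavic a) P := by
  have : (aeval a).comp (toNormal k) = aeval (R := k) (normalOctavic a) := by
    ext1 i
    have h := congrFun (normalOctavic_map (eval a) X) i
    simp only [Function.comp_def, eval_X] at h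
    simpa [toNormal, MvPolynomial.aeval_eq_eval] using h
  simpa [MvPolynomial.aeval_eq_eval] using DFunLike.congr_fun this P

lemma normalForm_eq : normalForm k = normalOctavic (var k) := rfl

lemma aeval_normalForm (P : MvPolynomial (Fin 9) k) :
    aeval (normalForm k) P = algebraMap _ (RatFunc3 k) (toNormal k P) := by
  have : ((Algebra.ofId (MvPolynomial (Fin 3) k) (RatFunc3 k)).restrictScalars k).comp
      (toNormal k) =
      aeval (R := k) (normalForm k) := by
    ext1 i
    have h := congrFun (normalOctavic_map (algebraMap (MvPolynomial (Fin 3) k) (RatFunc3 k)) X) i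
    simp only [normalForm_eq, AlgHom.coe_comp, Function.comp_apply, toNormal, aeval_X]
    exact h
  exact (DFunLike.congr_fun this P).symm

lemma toNormal_discPoly_ne_zero [IsAlgClosed k] [CharZero k] : toNormal k (discPoly k) ≠ 0 := by
  intro h
  have h0 := congrArg (eval 0) h
  rw [eval_toNormal, eval_discPoly, map_zero] at h0
  exact disc_ne_zero isNonsingular_fermat h0

/-- The nonsingular normal equations are Zariski dense. -/
lemma eq_zero_of_eval_normalOctavic [IsAlgClosed k] [CharZero k] {Q : MvPolynomial (Fin 3) k}
    (h : ∀ a : Fin 3 → k, IsNonsingular (normalOctavic a) → eval a Q = 0) : Q = 0 := by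
  refine (mul_eq_zero.1 (MvPolynomial.funext fun a => ?_)).resolve_right
    (toNormal_discPoly_ne_zero (k := k))
  rw [map_mul, map_zero, eval_toNormal, eval_discPoly]
  by_cases hD : disc (normalOctavic a) = 0
  · rw [hD, mul_zero]
  · rw [h a (isNonsingular_of_disc_ne_zero (by simp [evenOctavic]) hD), zero_mul]

lemma Represents.toNormal_ne_zero [CharZero k] {P D : MvPolynomial (Fin 9) k} {φ : H3 k → k}
    (h : Represents P D φ) : toNormal k D ≠ 0 := by
  intro h0
  have := congrArg (eval 0) h0
  rw [eval_toNormal, map_zero] at this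
  exact (h ⟨_, isNonsingular_fermat⟩).1 this

lemma Represents.aeval_ne_zero [CharZero k] {P D : MvPolynomial (Fin 9) k} {φ : H3 k → k}
    (h : Represents P D φ) : aeval (normalForm k) D ≠ 0 := by
  rw [aeval_normalForm]
  exact (map_ne_zero_iff _ (IsFractionRing.injective _ _)).2 h.toNormal_ne_zero

lemma Represents.div_eq_div [IsAlgClosed k] [CharZero k] {P D P' D' : MvPolynomial (Fin 9) k}
    {φ : H3 k → k} (h : Represents P D φ) (h' : Represents P' D' φ) :
    aeval (normalForm k) P / aeval (normalForm k) D =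
      aeval (normalForm k) P' / aeval (normalForm k) D' := by
  rw [div_eq_div_iff h.aeval_ne_zero h'.aeval_ne_zero, ← map_mul, ← map_mul, aeval_normalForm,
    aeval_normalForm]
  congr 1
  rw [← sub_eq_zero]
  refine eq_zero_of_eval_normalOctavic fun a ha => ?_
  have e := (h ⟨_, ha⟩).2
  have e' := (h' ⟨_, ha⟩).2
  dsimp only at e e'
  rw [map_sub, eval_toNormal, eval_toNormal, map_mul, map_mul, ← e, ← e']
  ring

lemma CoordRingH3.exists_represents (φ : CoordRingH3 k) : ∃ P D, Represents P D φ.toFun := φ.2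

lemma restrictL3_surjective : Function.Surjective (restrictL3 k) := Ideal.Quotient.mk_surjective

variable [IsAlgClosed k] [CharZero k]

/-- Pull-back of a regular function on `ℋ₃` along the generic normal equation. -/
noncomputable def pullbackFun (φ : CoordRingH3 k) : RatFunc3 k :=
  aeval (normalForm k) φ.exists_represents.choose /
    aeval (normalForm k) φ.exists_represents.choose_spec.choose

lemma pullbackFun_eq {φ : CoordRingH3 k} {P D : MvPolynomial (Fin 9) k}
    (h : Represents P D φ.toFun) :
    pullbackFun φ = aeval (normalForm k) P / aeval (normalForm k) D :=
  φ.exists_represents.choose_spec.choose_spec.div_eq_div h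

/-- Pull-back of regular functions on `ℋ₃` along the generic normal equation, as a homomorphism. -/
noncomputable def pullback (k : Type*) [Field k] [IsAlgClosed k] [CharZero k] :
    CoordRingH3 k →ₐ[k] RatFunc3 k where
  toFun := pullbackFun
  map_one' := by
    rw [pullbackFun_eq (P := 1) (D := 1) (fun c => by simp)]
    simp
  map_zero' := by
    rw [pullbackFun_eq (P := 0) (D := 1) (fun c => by simp)]
    simp
  map_mul' φ ψ := by
    obtain ⟨P, D, h⟩ := φ.exists_represents
    obtain ⟨Q, E, h'⟩ := ψ.exists_represents
    rw [pullbackFun_eq h, pullbackFun_eq h', pullbackFun_eq (P := P * Q) (D := D * E)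
      (fun c => ⟨by rw [map_mul]; exact mul_ne_zero (h c).1 (h' c).1, by
        rw [map_mul CoordRingH3.toFun, Pi.mul_apply, map_mul, map_mul, ← (h c).2, ← (h' c).2]
        ring⟩), map_mul, map_mul, div_mul_div_comm]
  map_add' φ ψ := by
    obtain ⟨P, D, h⟩ := φ.exists_represents
    obtain ⟨Q, E, h'⟩ := ψ.exists_represents
    rw [pullbackFun_eq h, pullbackFun_eq h', pullbackFun_eq (P := P * E + D * Q) (D := D * E)
      (fun c => ⟨by rw [map_mul]; exact mul_ne_zero (h c).1 (h' c).1, by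
        rw [map_add CoordRingH3.toFun, Pi.add_apply, map_mul, map_add, map_mul, map_mul,
          ← (h c).2, ← (h' c).2]
        ring⟩), div_add_div _ _ h.aeval_ne_zero h'.aeval_ne_zero, map_add, map_mul, map_mul,
        map_mul]
  commutes' r := by
    rw [pullbackFun_eq (P := C r) (D := 1) (fun c => by
      rw [AlgHom.commutes]
      simp)]
    simp

lemma pullback_eq {φ : CoordRingH3 k} {P D : MvPolynomial (Fin 9) k}
    (h : Represents P D φ.toFun) :
    pullback k φ = aeval (normalForm k) P / aeval (normalForm k) D :=
  pullbackFun_eq h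

lemma pullback_eq_zero_iff {φ : CoordRingH3 k} {P D : MvPolynomial (Fin 9) k}
    (h : Represents P D φ.toFun) : pullback k φ = 0 ↔ toNormal k P = 0 := by
  rw [pullback_eq h, div_eq_zero_iff, or_iff_left h.aeval_ne_zero, aeval_normalForm,
    map_eq_zero_iff _ (IsFractionRing.injective _ _)]

/-- A regular function vanishes on `ℒ₃` if and only if its pull-back is zero. -/
lemma mem_idealL3_iff (φ : CoordRingH3 k) : φ ∈ idealL3 k ↔ pullback k φ = 0 := by
  obtain ⟨P, D, h⟩ := φ.exists_represents
  rw [pullback_eq_zero_iff h]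
  constructor
  · intro hφ
    refine eq_zero_of_eval_normalOctavic fun a ha => ?_
    rw [eval_toNormal]
    have e := (h ⟨_, ha⟩).2
    rw [hφ _ ⟨⟨_, ha⟩, hasExtraInvolution_evenOctavic _ _ _ _ _, rfl⟩, zero_mul] at e
    exact e.symm
  · rintro hP p ⟨c, hc, rfl⟩
    obtain ⟨a, ha, hca⟩ := exists_equivalent_evenOctavic c hc
    have e := h ⟨_, ha⟩
    have hq : moduliPoint c = moduliPoint ⟨_, ha⟩ := Quot.sound hca
    rw [hq]
    refine (mul_eq_zero.1 (e.2.trans ?_)).resolve_right e.1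
    rw [← eval_toNormal, hP, map_zero]

lemma idealL3_eq_ker : idealL3 k = RingHom.ker (pullback k) := by
  ext φ
  rw [mem_idealL3_iff, RingHom.mem_ker]

lemma isPrime_idealL3 : (idealL3 k).IsPrime := by
  rw [idealL3_eq_ker]
  exact RingHom.ker_isPrime _

/-- The pull-back embedding of the coordinate ring of `ℒ₃`. -/
noncomputable def pullbackL3 (k : Type*) [Field k] [IsAlgClosed k] [CharZero k] :
    CoordRingL3 k →ₐ[k] RatFunc3 k :=
  Ideal.Quotient.liftₐ (idealL3 k) (pullback k) fun φ => (mem_idealL3_iff φ).1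

lemma pullbackL3_restrictL3 (φ : CoordRingH3 k) : pullbackL3 k (restrictL3 k φ) = pullback k φ :=
  rfl

lemma pullbackL3_injective : Function.Injective (pullbackL3 k) := by
  rw [injective_iff_map_eq_zero]
  intro x hx
  obtain ⟨φ, rfl⟩ := restrictL3_surjective x
  rw [pullbackL3_restrictL3, ← mem_idealL3_iff] at hx
  exact Ideal.Quotient.eq_zero_iff_mem.2 hx

lemma pullbackL3_ne_zero (s : nonZeroDivisors (CoordRingL3 k)) : pullbackL3 k s ≠ 0 := by
  have : Nontrivial (CoordRingL3 k) := (pullbackL3 k).toRingHom.domain_nontrivial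
  exact (map_ne_zero_iff _ pullbackL3_injective).2 (nonZeroDivisors.ne_zero s.2)

/-- The pull-back embedding of the function field of `ℒ₃`. -/
noncomputable def pullbackField (k : Type*) [Field k] [IsAlgClosed k] [CharZero k] :
    FunctionFieldL3 k →ₐ[k] RatFunc3 k :=
  IsLocalization.liftAlgHom (M := nonZeroDivisors (CoordRingL3 k)) (f := pullbackL3 k)
    fun s => (pullbackL3_ne_zero s).isUnit

lemma pullbackField_algebraMap (x : CoordRingL3 k) :
    pullbackField k (algebraMap _ (FunctionFieldL3 k) x) = pullbackL3 k x :=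
  IsLocalization.lift_eq _ x

lemma pullbackField_restrict (φ : CoordRingH3 k) :
    pullbackField k (restrict φ) = pullback k φ :=
  pullbackField_algebraMap _

lemma pullbackField_injective : Function.Injective (pullbackField k) := by
  rw [injective_iff_map_eq_zero]
  intro x hx
  obtain ⟨y, s, rfl⟩ := IsLocalization.exists_mk'_eq (nonZeroDivisors (CoordRingL3 k)) x
  have h := congrArg (pullbackField k) (IsLocalization.mk'_spec (FunctionFieldL3 k) y s)
  rw [map_mul, hx, zero_mul, pullbackField_algebraMap] at h
  rw [pullbackL3_injective (h.symm.trans (map_zero _).symm), IsLocalization.mk'_zero]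

lemma isPullback_pullbackField : IsPullback (pullbackField k) := fun φ _ _ h =>
  ⟨h.aeval_ne_zero, (pullbackField_restrict φ).trans (pullback_eq h)⟩

lemma mem_range_pullbackField {x : RatFunc3 k} : x ∈ (pullbackField k).range ↔
    ∃ φ ψ : CoordRingH3 k, pullback k ψ ≠ 0 ∧ x = pullback k φ / pullback k ψ := by
  constructor
  · rintro ⟨x, rfl⟩
    obtain ⟨y, s, rfl⟩ := IsLocalization.exists_mk'_eq (nonZeroDivisors (CoordRingL3 k)) x
    obtain ⟨φ, rfl⟩ := restrictL3_surjective y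
    obtain ⟨ψ, hψ⟩ := restrictL3_surjective (s : CoordRingL3 k)
    have h0 := pullbackL3_ne_zero s
    have h := congrArg (pullbackField k)
      (IsLocalization.mk'_spec (FunctionFieldL3 k) (restrictL3 k φ) s)
    rw [map_mul, pullbackField_algebraMap, pullbackField_algebraMap, pullbackL3_restrictL3] at h
    rw [← hψ, pullbackL3_restrictL3] at h h0
    exact ⟨φ, ψ, h0, eq_div_of_mul_eq h0 h⟩
  · rintro ⟨φ, ψ, h, rfl⟩
    have : IsDomain (CoordRingL3 k) := pullbackL3_injective.isDomain (pullbackL3 k).toRingHom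
    have hs : restrictL3 k ψ ∈ nonZeroDivisors (CoordRingL3 k) := by
      rw [mem_nonZeroDivisors_iff_ne_zero]
      intro h0
      rw [← pullbackL3_restrictL3, h0, map_zero] at h
      exact h rfl
    refine ⟨IsLocalization.mk' _ (restrictL3 k φ) ⟨_, hs⟩, ?_⟩
    refine eq_div_of_mul_eq h ?_
    have h := congrArg (pullbackField k)
      (IsLocalization.mk'_spec (FunctionFieldL3 k) (restrictL3 k φ) ⟨_, hs⟩)
    rwa [map_mul, pullbackField_algebraMap, pullbackField_algebraMap, pullbackL3_restrictL3,
      pullbackL3_restrictL3] at h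

end

/-! ### The dihedral invariants as quotients of invariants of octavics -/

section
open MvPolynomial
variable {k : Type*} [Field k]

section
variable [IsAlgClosed k] [CharZero k]

lemma eval_discPoly_ne_zero (c : Octavics k) : eval c.1 (discPoly k) ≠ 0 := by
  rw [eval_discPoly]
  exact disc_ne_zero c.2

/-- An invariant whose degree is that of a power of the discriminant gives a regular function. -/
lemma IsInvariant.exists_pullback_eq {m : ℕ} {I : MvPolynomial (Fin 9) k}
    (hI : IsInvariant (14 * m) I) : ∃ φ : CoordRingH3 k,
      pullback k φ = aeval (normalForm k) I / aeval (normalForm k) (discPoly k) ^ m := by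
  let φ : H3 k → k := Quot.lift (fun c => eval c.1 I / eval c.1 (discPoly k) ^ m) (by
    intro c c' h
    obtain ⟨μ, hμ, h⟩ := h.exists_eval_eq
    have hD := eval_discPoly_ne_zero c
    rw [h _ _ hI, h _ _ isInvariant_discPoly, mul_pow, ← pow_mul,
      mul_div_mul_left _ _ (pow_ne_zero _ hμ)])
  have hφ : Represents I (discPoly k ^ m) φ := fun c => by
    have hD := pow_ne_zero m (eval_discPoly_ne_zero c)
    rw [map_pow]
    exact ⟨hD, div_mul_cancel₀ _ hD⟩
  have hmem : φ ∈ coordRing k := ⟨_, _, hφ⟩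
  let Φ : CoordRingH3 k := (⟨φ, hmem⟩ : coordRing k)
  exact ⟨Φ, (pullback_eq (φ := Φ) hφ).trans (by rw [map_pow])⟩

lemma aeval_discPoly_ne_zero : aeval (normalForm k) (discPoly k) ≠ 0 := by
  rw [aeval_normalForm]
  exact (map_ne_zero_iff _ (IsFractionRing.injective _ _)).2 toNormal_discPoly_ne_zero

end

/-- The rational function `x` is the quotient of the restrictions to the normal equation of two
homogeneous invariants, the difference of whose degrees is `n`. -/
def IsInvariantQuotient (n : ℤ) (x : RatFunc3 k) : Prop :=
  ∃ (d e : ℕ) (I J : MvPolynomial (Fin 9) k), IsInvariant d I ∧ IsInvariant e J ∧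
    aeval (normalForm k) J ≠ 0 ∧ (d : ℤ) = n + e ∧
    x = aeval (normalForm k) I / aeval (normalForm k) J

namespace IsInvariantQuotient
variable {m n : ℤ} {x y : RatFunc3 k}

lemma mul (hx : IsInvariantQuotient m x) (hy : IsInvariantQuotient n y) :
    IsInvariantQuotient (m + n) (x * y) := by
  obtain ⟨d, e, I, J, hI, hJ, h0, h, rfl⟩ := hx
  obtain ⟨d', e', I', J', hI', hJ', h0', h', rfl⟩ := hy
  refine ⟨_, _, _, _, hI.mul hI', hJ.mul hJ', ?_, ?_, ?_⟩
  · rw [map_mul]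
    exact mul_ne_zero h0 h0'
  · push_cast
    linarith
  · rw [map_mul, map_mul, div_mul_div_comm]

lemma add (hx : IsInvariantQuotient n x) (hy : IsInvariantQuotient n y) :
    IsInvariantQuotient n (x + y) := by
  obtain ⟨d, e, I, J, hI, hJ, h0, h, rfl⟩ := hx
  obtain ⟨d', e', I', J', hI', hJ', h0', h', rfl⟩ := hy
  have hd : e + d' = d + e' := by omega
  refine ⟨_, _, _, _, (hI.mul hJ').add (hd ▸ hJ.mul hI'), hJ.mul hJ', ?_, ?_, ?_⟩
  · rw [map_mul]
    exact mul_ne_zero h0 h0'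
  · push_cast
    linarith
  · rw [map_add, map_mul, map_mul, map_mul, div_add_div _ _ h0 h0']

lemma congr (hx : IsInvariantQuotient m x) (h : m = n) : IsInvariantQuotient n x := h ▸ hx

lemma div (hx : IsInvariantQuotient m x) (hy : IsInvariantQuotient n y) (h : y ≠ 0) :
    IsInvariantQuotient (m - n) (x / y) := by
  obtain ⟨d', e', I', J', hI', hJ', h0', h', rfl⟩ := hy
  have : IsInvariantQuotient (-n) (aeval (normalForm k) J' / aeval (normalForm k) I') :=
    ⟨_, _, _, _, hJ', hI', (div_ne_zero_iff.1 h).1, by linarith, rfl⟩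
  rw [sub_eq_add_neg, div_eq_mul_inv, inv_div]
  exact hx.mul this

lemma of_mul_eq {l : ℤ} {z : RatFunc3 k} (hx : IsInvariantQuotient m x)
    (hy : IsInvariantQuotient n y) (h0 : y ≠ 0) (h : z * y = x) (hl : m - n = l) :
    IsInvariantQuotient l z := by
  rw [eq_div_of_mul_eq h0 h]
  exact (hx.div hy h0).congr hl

variable [CharZero k]

lemma of_isInvariant {d : ℕ} {I : MvPolynomial (Fin 9) k} (hI : IsInvariant d I) :
    IsInvariantQuotient d (aeval (normalForm k) I) :=
  ⟨d, 0, I, C 1, hI, isInvariant_C 1, by simp, by simp, by simp⟩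

lemma const (a : k) : IsInvariantQuotient 0 (algebraMap k (RatFunc3 k) a) := by
  simpa using of_isInvariant (isInvariant_C a)

lemma const_mul (a : k) (hx : IsInvariantQuotient n x) :
    IsInvariantQuotient n (algebraMap k (RatFunc3 k) a * x) := by
  simpa using (const a).mul hx

lemma ofNat_mul (a : ℕ) [a.AtLeastTwo] (hx : IsInvariantQuotient n x) :
    IsInvariantQuotient n (ofNat(a) * x) := by
  rw [← map_ofNat (algebraMap k (RatFunc3 k)) a]
  exact hx.const_mul _

lemma of_ofNat_mul (a : ℕ) [a.AtLeastTwo] (hx : IsInvariantQuotient n (ofNat(a) * x)) :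
    IsInvariantQuotient n x := by
  have h : IsInvariantQuotient 0 (ofNat(a) : RatFunc3 k) := by
    rw [← map_ofNat (algebraMap k (RatFunc3 k)) a]
    exact const _
  exact hx.of_mul_eq h (OfNat.ofNat_ne_zero a) (mul_comm _ _) (by simp)

lemma neg (hx : IsInvariantQuotient n x) : IsInvariantQuotient n (-x) := by
  simpa using hx.const_mul (-1)

lemma sub (hx : IsInvariantQuotient n x) (hy : IsInvariantQuotient n y) :
    IsInvariantQuotient n (x - y) := by
  rw [sub_eq_add_neg]
  exact hx.add hy.neg

lemma pow (hx : IsInvariantQuotient n x) (i : ℕ) : IsInvariantQuotient (i * n) (x ^ i) := by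
  induction i with
  | zero => simpa using const (k := k) 1
  | succ i ih =>
    rw [pow_succ]
    push_cast
    rw [add_mul, one_mul]
    exact ih.mul hx

lemma of_moment (i : ℕ) : IsInvariantQuotient (4 + i) (moment i (normalForm k)) := by
  have h := of_isInvariant (isInvariant_moment (k := k) i)
  have e := moment_map (aeval (R := k) (normalForm k) : _ →ₐ[k] RatFunc3 k).toRingHom i X
  have e' : (aeval (R := k) (normalForm k) : _ →ₐ[k] RatFunc3 k).toRingHom ∘ X = normalForm k := by
    ext i
    simp
  rw [e'] at e
  rw [← e]
  exact_mod_cast h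

lemma of_traceSq : IsInvariantQuotient 2 (traceSq (normalForm k)) := by
  have h := of_isInvariant (isInvariant_traceSq (k := k))
  have e := traceSq_map (aeval (R := k) (normalForm k) : _ →ₐ[k] RatFunc3 k).toRingHom X
  have e' : (aeval (R := k) (normalForm k) : _ →ₐ[k] RatFunc3 k).toRingHom ∘ X = normalForm k := by
    ext i
    simp
  rw [e'] at e
  rw [← e]
  exact_mod_cast h

lemma hankel_normalForm_ne_zero : hankel (normalForm k) ≠ 0 := by
  have h := hankel_map (algebraMap (MvPolynomial (Fin 3) k) (RatFunc3 k)) (normalOctavic X)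
  rw [normalOctavic_map] at h
  change _ = hankel (normalForm k) at h
  rw [← h, map_ne_zero_iff _ (IsFractionRing.injective _ _)]
  intro h0
  have h1 := hankel_map (eval (![0, 0, 1] : Fin 3 → k)) (normalOctavic X)
  rw [h0, map_zero, normalOctavic_map] at h1
  have e : eval (![0, 0, 1] : Fin 3 → k) ∘ X = ![0, 0, 1] := by
    ext i
    simp
  rw [e] at h1
  exact hankel_ne_zero (R := k) h1.symm

lemma moment_mul_mul (i j l : ℕ) {n : ℤ} (h : (12 + i + j + l : ℤ) = n) :
    IsInvariantQuotient n (moment i (normalForm k) *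
      moment j (normalForm k) *
      moment l (normalForm k)) :=
  (((of_moment i).mul (of_moment j)).mul (of_moment l)).congr (by linarith)

/-- Cramer's rule for the recurrence of the moments. -/
lemma evenTrace_evenMinor_evenDet :
    IsInvariantQuotient 1 (evenTrace (var k 1)) ∧
    IsInvariantQuotient 2 (evenMinor 1 (var k 0) (var k 1) (var k 2) 1) ∧
    IsInvariantQuotient 3 (evenDet 1 (var k 0) (var k 1) (var k 2) 1) := by
  have hn := hankel_normalForm_ne_zero (k := k)
  have r0 := moment_evenOctavic 1 (var k 0) (var k 1) (var k 2) 1 0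
  have r1 := moment_evenOctavic 1 (var k 0) (var k 1) (var k 2) 1 1
  have r2 := moment_evenOctavic 1 (var k 0) (var k 1) (var k 2) 1 2
  change moment 3 (normalForm k) =
    _ * moment 2 (normalForm k) -
    _ * moment 1 (normalForm k) +
    _ * moment 0 (normalForm k) at r0
  change moment 4 (normalForm k) =
    _ * moment 3 (normalForm k) -
    _ * moment 2 (normalForm k) +
    _ * moment 1 (normalForm k) at r1
  change moment 5 (normalForm k) =
    _ * moment 4 (normalForm k) -
    _ * moment 3 (normalForm k) +
    _ * moment 2 (normalForm k) at r2
  have w := moment_mul_mul (k := k)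
  obtain ⟨H, hH, wH⟩ : ∃ H, hankel (normalForm k) = H ∧ IsInvariantQuotient 18 H := by
    refine ⟨_, ?_, ((((w 0 2 4 rfl).sub (w 0 3 3 rfl)).sub (w 1 1 4 rfl)).add
      (w 1 2 3 rfl)).add ((w 1 2 3 rfl).sub (w 2 2 2 rfl))⟩
    rw [hankel]
    ring
  have w1 := ((((w 0 2 5 rfl).sub (w 0 3 4 rfl)).sub (w 1 1 5 rfl)).add
      (w 1 2 4 rfl)).add ((w 1 3 3 rfl).sub (w 2 2 3 rfl))
  have w2 := ((((w 0 3 5 rfl).sub (w 0 4 4 rfl)).add (w 1 3 4 rfl)).sub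
      (w 2 3 3 rfl)).add ((w 2 2 4 rfl).sub (w 1 2 5 rfl))
  have w3 := ((((w 2 3 4 rfl).sub (w 3 3 3 rfl)).sub (w 1 4 4 rfl)).add
      (w 1 3 5 rfl)).add ((w 2 3 4 rfl).sub (w 2 2 5 rfl))
  rw [hH] at hn
  rw [hankel] at hH
  generalize moment 0 (normalForm k) = m0 at *
  generalize moment 1 (normalForm k) = m1 at *
  generalize moment 2 (normalForm k) = m2 at *
  generalize moment 3 (normalForm k) = m3 at *
  generalize moment 4 (normalForm k) = m4 at *
  generalize moment 5 (normalForm k) = m5 at *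
  refine ⟨?_, ?_, ?_⟩
  · refine w1.of_mul_eq wH hn ?_ rfl
    rw [← hH]
    linear_combination -(m1 * m3 - m2 ^ 2) * r0 + (m0 * m3 - m1 * m2) * r1
      - (m0 * m2 - m1 ^ 2) * r2
  · refine w2.of_mul_eq wH hn ?_ rfl
    rw [← hH]
    linear_combination -(m1 * m4 - m3 * m2) * r0 + (m0 * m4 - m2 ^ 2) * r1
      - (m0 * m3 - m2 * m1) * r2
  · refine w3.of_mul_eq wH hn ?_ rfl
    rw [← hH]
    linear_combination -(m2 * m4 - m3 ^ 2) * r0 + (m1 * m4 - m3 * m2) * r1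
      - (m1 * m3 - m2 ^ 2) * r2

lemma of_dihedral (i : Fin 3) : IsInvariantQuotient 0 (dihedral k i) := by
  obtain ⟨hs, hr, hq⟩ := evenTrace_evenMinor_evenDet (k := k)
  have ht := of_traceSq (k := k)
  have e := traceSq_evenOctavic 1 (var k 0) (var k 1) (var k 2) 1
  change traceSq (normalForm k) = _ at e
  rw [e] at ht
  -- the degrees of `a₂`, `a₁ a₃`, `a₁² + a₃²` and of the product of the outer coefficients, which
  -- is `1` on the normal equation
  have h1 : IsInvariantQuotient 1 (var k 1) := hs.of_ofNat_mul 32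
  have h11 : IsInvariantQuotient 2 (var k 1 ^ 2) := (h1.pow 2).congr (by norm_num)
  have h02 : IsInvariantQuotient 2 (var k 0 * var k 2) := by
    refine of_ofNat_mul 3200 ?_
    convert (ht.add (hr.ofNat_mul 2)).sub (h11.ofNat_mul 1536) using 1
    ring
  have one : IsInvariantQuotient 2 (1 : RatFunc3 k) := by
    refine of_ofNat_mul 78400 ?_
    convert ((h11.ofNat_mul 208).sub (h02.ofNat_mul 1200)).sub hr using 1
    rw [evenMinor]
    ring
  have h3 : IsInvariantQuotient 3 (var k 0 ^ 2 + var k 2 ^ 2) := by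
    refine of_ofNat_mul 168000 ?_
    convert ((hq.sub (((h1.pow 3).congr (by norm_num)).ofNat_mul 384)).add
      (((h1.mul h02).congr (by norm_num)).ofNat_mul 4800)).add
      (((h1.mul one).congr (by norm_num)).ofNat_mul 1881600) using 1
    rw [evenDet]
    ring
  fin_cases i
  · refine (((h3.pow 2).congr (n := 6) (by norm_num)).sub
      (((((h02.pow 2).mul one).congr (by norm_num)).ofNat_mul 2))).of_mul_eq (n := 6)
      ((one.pow 3).congr (by norm_num)) (by simp) ?_ (by norm_num)
    simp [dihedral]
    ring
  · refine (h3.mul h1).of_mul_eq ((one.pow 2).congr (n := 4) (by norm_num)) (by simp) ?_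
      (by norm_num)
    simp [dihedral]
  · refine (h02.ofNat_mul 2).of_mul_eq one (by simp) ?_ (by norm_num)
    simp [dihedral]
    ring

variable [IsAlgClosed k]

lemma mem_range (hx : IsInvariantQuotient 0 x) : x ∈ (pullbackField k).range := by
  obtain ⟨d, e, I, J, hI, hJ, h0, h, rfl⟩ := hx
  obtain rfl : d = e := by omega
  -- both fractions are multiplied by powers of `J` to reach the degree of a power of `disc`
  have h1 : IsInvariant (14 * d) (I * J ^ 13) := by
    have := hI.mul (hJ.pow 13)
    rwa [show d + d * 13 = 14 * d by ring] at this
  have h2 : IsInvariant (14 * d) (J ^ 14) := mul_comm d 14 ▸ hJ.pow 14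
  obtain ⟨φ, hφ⟩ := h1.exists_pullback_eq
  obtain ⟨ψ, hψ⟩ := h2.exists_pullback_eq
  have hD := pow_ne_zero d (aeval_discPoly_ne_zero (k := k))
  have hψ0 : pullback k ψ ≠ 0 := by
    rw [hψ, map_pow]
    exact div_ne_zero (pow_ne_zero _ h0) hD
  refine mem_range_pullbackField.2 ⟨φ, ψ, hψ0, ?_⟩
  rw [hφ, hψ, map_mul, map_pow, map_pow, div_div_div_cancel_right₀ hD]
  field_simp

end IsInvariantQuotient

lemma adjoin_dihedral_le [IsAlgClosed k] [CharZero k] :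
    (IntermediateField.adjoin k (Set.range (dihedral k))).toSubalgebra ≤
      (pullbackField k).range := by
  let K : IntermediateField k (RatFunc3 k) := {
    (pullbackField k).range with
    inv_mem' := fun x hx => by
      obtain ⟨φ, ψ, hψ, rfl⟩ := mem_range_pullbackField.1 hx
      by_cases hφ : pullback k φ = 0
      · rw [hφ, zero_div, inv_zero]
        exact (pullbackField k).range.zero_mem
      · exact mem_range_pullbackField.2 ⟨ψ, φ, hφ, inv_div _ _⟩ }
  have h : IntermediateField.adjoin k (Set.range (dihedral k)) ≤ K := by
    rw [IntermediateField.adjoin_le_iff]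
    rintro _ ⟨i, rfl⟩
    exact (IsInvariantQuotient.of_dihedral i).mem_range
  exact h

end

/-! ### Symmetries of the family of normal equations -/

section
open MvPolynomial
variable {k : Type*} [Field k] [IsAlgClosed k] [CharZero k]

/-- An automorphism of the parameter space of normal equations that is induced by a substitution of
octavics fixes all pull-backs of regular functions on `ℋ₃`. -/
lemma exists_algEquiv_pullback_eq (l l' : Fin 3 → MvPolynomial (Fin 3) k)
    (h : ∀ i, aeval l (l' i) = X i) (h' : ∀ i, aeval l' (l i) = X i)
    (M : Matrix (Fin 2) (Fin 2) k) (hM : M.det ≠ 0)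
    (hl : ∀ a : Fin 3 → k, octavic (normalOctavic fun i => eval a (l i)) =
      substMatrix M (octavic (normalOctavic a))) :
    ∃ σ : RatFunc3 k ≃ₐ[k] RatFunc3 k,
      (∀ i, σ (var k i) = algebraMap (MvPolynomial (Fin 3) k) (RatFunc3 k) (l i)) ∧
        ∀ φ, σ (pullback k φ) = pullback k φ := by
  let g : MvPolynomial (Fin 3) k ≃ₐ[k] MvPolynomial (Fin 3) k :=
    AlgEquiv.ofAlgHom (aeval l) (aeval l')
      (by ext1 i; rw [AlgHom.comp_apply, aeval_X, h, AlgHom.id_apply])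
      (by ext1 i; rw [AlgHom.comp_apply, aeval_X, h', AlgHom.id_apply])
  let σ : RatFunc3 k ≃ₐ[k] RatFunc3 k := IsFractionRing.algEquivOfAlgEquiv g
  have hσ (Q : MvPolynomial (Fin 3) k) : σ (algebraMap _ (RatFunc3 k) Q) =
      algebraMap _ (RatFunc3 k) (aeval l Q) :=
    IsFractionRing.algEquivOfAlgEquiv_algebraMap g Q
  have hg (a : Fin 3 → k) (Q : MvPolynomial (Fin 3) k) :
      eval a (aeval l Q) = eval (fun i => eval a (l i)) Q := by
    have : (aeval (R := k) a).comp (aeval l) = aeval (R := k) fun i => eval a (l i) := by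
      ext1 i
      simp [MvPolynomial.aeval_eq_eval]
    simpa [MvPolynomial.aeval_eq_eval] using DFunLike.congr_fun this Q
  refine ⟨σ, fun i => by rw [var, hσ, aeval_X], fun φ => ?_⟩
  obtain ⟨P, D, hφ⟩ := φ.exists_represents
  have hD := hφ.aeval_ne_zero
  rw [pullback_eq hφ, map_div₀, div_eq_div_iff ((map_ne_zero _).2 hD) hD]
  rw [aeval_normalForm, aeval_normalForm, hσ, hσ, ← map_mul, ← map_mul]
  congr 1
  rw [← sub_eq_zero]
  refine eq_zero_of_eval_normalOctavic fun a ha => ?_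
  have hb := ha.of_substMatrix hM (hl a)
  have e : moduliPoint ⟨_, ha⟩ = moduliPoint ⟨_, hb⟩ :=
    Quot.sound ⟨Matrix.GeneralLinearGroup.mkOfDetNeZero M hM, hl a⟩
  have e1 := (hφ ⟨_, ha⟩).2
  have e2 := (hφ ⟨_, hb⟩).2
  rw [← e] at e2
  dsimp only at e1 e2
  rw [map_sub, map_mul, map_mul, hg, hg, eval_toNormal, eval_toNormal, eval_toNormal,
    eval_toNormal, ← e1, ← e2]
  ring

/-- The symmetry induced by `X ↦ ηX`, where `η ^ 2 = ζ`. -/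
lemma exists_rotation {ζ : k} (hζ : ζ ^ 2 = -1) : ∃ σ : RatFunc3 k ≃ₐ[k] RatFunc3 k,
    σ (var k 0) = algebraMap k _ ζ * var k 0 ∧ σ (var k 1) = -var k 1 ∧
    σ (var k 2) = -(algebraMap k _ ζ * var k 2) ∧ ∀ φ, σ (pullback k φ) = pullback k φ := by
  obtain ⟨η, hη⟩ := IsAlgClosed.exists_pow_nat_eq ζ two_pos
  have hη0 : η ≠ 0 := by
    rintro rfl
    rw [← hη] at hζ
    norm_num at hζ
  have hC : (C ζ : MvPolynomial (Fin 3) k) ^ 2 = -1 := by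
    rw [← map_pow, hζ]
    simp
  obtain ⟨σ, h, h'⟩ := exists_algEquiv_pullback_eq
    ![C ζ * X 0, -X 1, -(C ζ * X 2)] ![-(C ζ * X 0), -X 1, C ζ * X 2]
    (by
      intro i
      fin_cases i <;> simp [MvPolynomial.algebraMap_eq]
      · linear_combination -X 0 * hC
      · linear_combination -X 2 * hC)
    (by
      intro i
      fin_cases i <;> simp [MvPolynomial.algebraMap_eq]
      · linear_combination -X 0 * hC
      · linear_combination -X 2 * hC)
    !![η, 0; 0, 1] (by simpa [Matrix.det_fin_two] using hη0) (fun a => by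
      rw [← octavic_diagonal]
      congr 1
      ext i
      have h4 : η ^ 4 = -1 := by rw [← hζ, ← hη]; ring
      fin_cases i <;> simp [evenOctavic]
      · exact Or.inl hη.symm
      · rw [h4]; ring
      · linear_combination (-a 2) * (η ^ 2 * h4 - hη)
      · linear_combination (1 - η ^ 4) * h4)
  refine ⟨σ, ?_, ?_, ?_, h'⟩
  · simpa [var, IsScalarTower.algebraMap_apply k (MvPolynomial (Fin 3) k) (RatFunc3 k),
      MvPolynomial.algebraMap_eq] using h 0
  · simpa [var] using h 1
  · simpa [var, IsScalarTower.algebraMap_apply k (MvPolynomial (Fin 3) k) (RatFunc3 k),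
      MvPolynomial.algebraMap_eq] using h 2

/-- The symmetry induced by the interchange of `X` and `Z`. -/
lemma exists_reflection : ∃ σ : RatFunc3 k ≃ₐ[k] RatFunc3 k,
    σ (var k 0) = var k 2 ∧ σ (var k 1) = var k 1 ∧
    σ (var k 2) = var k 0 ∧ ∀ φ, σ (pullback k φ) = pullback k φ := by
  obtain ⟨σ, h, h'⟩ := exists_algEquiv_pullback_eq (k := k) ![X 2, X 1, X 0] ![X 2, X 1, X 0]
    (by intro i; fin_cases i <;> simp) (by intro i; fin_cases i <;> simp)
    !![0, 1; 1, 0] (by simp [Matrix.det_fin_two]) (fun a => by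
      rw [← octavic_reverse]
      congr 1
      ext i
      fin_cases i <;> simp [evenOctavic, reverse, Fin.rev])
  exact ⟨σ, h 0, h 1, h 2, h'⟩

/-! ### The field generated by the dihedral invariants -/

/-- The field `k(u₁, u₂, u₃)`. -/
noncomputable abbrev dihedralField (k : Type*) [Field k] : IntermediateField k (RatFunc3 k) :=
  IntermediateField.adjoin k (Set.range (dihedral k))

omit [IsAlgClosed k] [CharZero k] in
lemma dihedral_mem (i : Fin 3) : dihedral k i ∈ dihedralField k :=
  IntermediateField.subset_adjoin _ _ ⟨i, rfl⟩

omit [IsAlgClosed k] [CharZero k] in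
lemma eq_top_of_var_mem {L : IntermediateField k (RatFunc3 k)} (h : ∀ i, var k i ∈ L) : L = ⊤ := by
  have hp (p : MvPolynomial (Fin 3) k) : algebraMap _ (RatFunc3 k) p ∈ L := by
    induction p using MvPolynomial.induction_on with
    | C a =>
      rw [← MvPolynomial.algebraMap_eq, ← IsScalarTower.algebraMap_apply]
      exact L.algebraMap_mem a
    | add p q hp hq => rw [map_add]; exact L.add_mem hp hq
    | mul_X p i hp => rw [map_mul]; exact L.mul_mem hp (h i)
  rw [eq_top_iff]
  rintro x -
  obtain ⟨p, q, -, rfl⟩ := IsFractionRing.div_surjective (A := MvPolynomial (Fin 3) k) x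
  exact L.div_mem (hp p) (hp q)

omit [IsAlgClosed k] [CharZero k] in
lemma var_sq_add_var_sq_ne_zero : var k 0 ^ 2 + var k 2 ^ 2 ≠ 0 := by
  have e : var k 0 ^ 2 + var k 2 ^ 2 =
      algebraMap (MvPolynomial (Fin 3) k) (RatFunc3 k) (X 0 ^ 2 + X 2 ^ 2) := by
    simp [var]
  rw [e, map_ne_zero_iff _ (IsFractionRing.injective _ _)]
  intro h
  simpa using congrArg (eval (![1, 0, 0] : Fin 3 → k)) h

omit [IsAlgClosed k] [CharZero k] in
lemma var_ne_zero (i : Fin 3) : var k i ≠ 0 :=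
  (map_ne_zero_iff _ (IsFractionRing.injective _ _)).2 (X_ne_zero i)

/-- The monic polynomial `(T ^ 4 - a₁ ^ 4) * (T ^ 4 - a₃ ^ 4)` over the field generated by the
dihedral invariants. -/
noncomputable def dihedralPoly (k : Type*) [Field k] : Polynomial (dihedralField k) :=
  Polynomial.X ^ 8 - Polynomial.C ⟨_, dihedral_mem 0⟩ * Polynomial.X ^ 4 +
    Polynomial.C ((⟨_, dihedral_mem 2⟩ / 2) ^ 4)

omit [IsAlgClosed k] in
lemma aeval_dihedralPoly : Polynomial.aeval (var k 0) (dihedralPoly k) = 0 := by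
  have h (x : dihedralField k) : algebraMap (dihedralField k) (RatFunc3 k) x = x := rfl
  have h2 : ((2 : dihedralField k) : RatFunc3 k) = 2 := rfl
  simp [dihedralPoly, h, h2]
  simp [dihedral]
  ring

omit [IsAlgClosed k] [CharZero k] in
lemma monic_dihedralPoly : (dihedralPoly k).Monic := by
  unfold dihedralPoly
  monicity!

omit [IsAlgClosed k] [CharZero k] in
lemma natDegree_dihedralPoly : (dihedralPoly k).natDegree = 8 := by
  unfold dihedralPoly
  compute_degree!

omit [IsAlgClosed k] in
lemma adjoin_var_zero_eq_top :
    IntermediateField.adjoin (dihedralField k) {var k 0} = ⊤ := by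
  have h0 : var k 0 ∈ IntermediateField.adjoin (dihedralField k) {var k 0} :=
    IntermediateField.mem_adjoin_simple_self _ _
  have hF (i : Fin 3) : dihedral k i ∈ IntermediateField.adjoin (dihedralField k) {var k 0} :=
    (IntermediateField.adjoin (dihedralField k) {var k 0}).algebraMap_mem ⟨_, dihedral_mem i⟩
  have h2 : var k 2 ∈ IntermediateField.adjoin (dihedralField k) {var k 0} := by
    have e : var k 2 = dihedral k 2 / (2 * var k 0) := by
      have := var_ne_zero (k := k) 0
      simp [dihedral]
      field_simp
    rw [e]
    exact div_mem (hF 2) (mul_mem (ofNat_mem _ 2) h0)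
  have h1 : var k 1 ∈ IntermediateField.adjoin (dihedralField k) {var k 0} := by
    have e : var k 1 = dihedral k 1 / (var k 0 ^ 2 + var k 2 ^ 2) := by
      have := var_sq_add_var_sq_ne_zero (k := k)
      simp [dihedral]
      field_simp
    rw [e]
    exact div_mem (hF 1) (add_mem (pow_mem h0 2) (pow_mem h2 2))
  have h := eq_top_of_var_mem (k := k)
    (L := (IntermediateField.adjoin (dihedralField k) {var k 0}).restrictScalars k)
    (by intro i; fin_cases i <;> assumption)
  rw [eq_top_iff]
  intro x _
  have : x ∈ (⊤ : IntermediateField k (RatFunc3 k)) := trivial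
  rwa [← h] at this

omit [IsAlgClosed k] in
lemma exists_aeval_var_eq (x : RatFunc3 k) : ∃ h : Polynomial (dihedralField k),
    h.natDegree < 8 ∧ Polynomial.aeval (var k 0) h = x := by
  have hx : x ∈ (⊤ : IntermediateField (dihedralField k) (RatFunc3 k)) := trivial
  have halg : IsAlgebraic (dihedralField k) (var k 0) :=
    ⟨_, monic_dihedralPoly.ne_zero, aeval_dihedralPoly⟩
  rw [← adjoin_var_zero_eq_top, ← IntermediateField.mem_toSubalgebra,
    IntermediateField.adjoin_simple_toSubalgebra_of_isAlgebraic halg,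
    Algebra.adjoin_singleton_eq_range_aeval] at hx
  obtain ⟨h, rfl⟩ := hx
  refine ⟨h %ₘ dihedralPoly k, ?_, ?_⟩
  · rw [← natDegree_dihedralPoly (k := k)]
    exact Polynomial.natDegree_modByMonic_lt _ monic_dihedralPoly fun h => by
      simpa [h] using natDegree_dihedralPoly (k := k)
  · exact (Polynomial.aeval_modByMonic_eq_self_of_root aeval_dihedralPoly)

lemma range_pullbackField_le :
    (pullbackField k).range ≤ (dihedralField k).toSubalgebra := by
  suffices H : ∀ φ, pullback k φ ∈ dihedralField k by
    intro x hx
    obtain ⟨φ, ψ, -, rfl⟩ := mem_range_pullbackField.1 hx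
    exact (dihedralField k).div_mem (H φ) (H ψ)
  intro φ
  obtain ⟨h, hdeg, hφ⟩ := exists_aeval_var_eq (pullback k φ)
  obtain ⟨ζ, hζ⟩ := IsAlgClosed.exists_pow_nat_eq (-1 : k) two_pos
  obtain ⟨σ, hσ0, hσ1, hσ2, hσ⟩ := exists_rotation hζ
  obtain ⟨τ, hτ0, hτ1, hτ2, hτ⟩ := exists_reflection (k := k)
  have hz : algebraMap k (RatFunc3 k) ζ ^ 2 = -1 := by
    rw [← map_pow, hζ, map_neg, map_one]
  set z := algebraMap k (RatFunc3 k) ζ with hz'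
  have hζ4 : IsPrimitiveRoot ζ 4 := by
    have := orderOf_eq_prime_pow (x := ζ) (p := 2) (n := 1) (by
      rw [pow_one, hζ]
      exact fun h => two_ne_zero (α := k) (by linear_combination -h))
      (by linear_combination (ζ ^ 2 - 1) * hζ)
    simpa [this] using IsPrimitiveRoot.orderOf ζ
  -- an automorphism that fixes the dihedral invariants permutes the points where `h` takes the value
  -- `pullback k φ`
  have key (s : RatFunc3 k ≃ₐ[k] RatFunc3 k) (hs : ∀ i, s (dihedral k i) = dihedral k i)
      (hsφ : s (pullback k φ) = pullback k φ) {x : RatFunc3 k}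
      (hx : Polynomial.aeval x h = pullback k φ) :
      Polynomial.aeval (s x) h = pullback k φ := by
    have hF : (s : RatFunc3 k →+* RatFunc3 k).comp (algebraMap (dihedralField k) (RatFunc3 k)) =
        algebraMap (dihedralField k) (RatFunc3 k) := by
      have : (s : RatFunc3 k →ₐ[k] RatFunc3 k).comp (dihedralField k).val =
          (dihedralField k).val := by
        refine IntermediateField.algHom_ext_of_eq_adjoin _ rfl ?_
        rintro _ ⟨i, rfl⟩
        exact hs i
      ext x
      exact DFunLike.congr_fun this x
    rw [Polynomial.aeval_def] at hx ⊢
    have := Polynomial.hom_eval₂ h (algebraMap (dihedralField k) (RatFunc3 k))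
      (s : RatFunc3 k →+* RatFunc3 k) x
    rw [hF, hx] at this
    exact this.symm.trans hsφ
  have hσd (i : Fin 3) : σ (dihedral k i) = dihedral k i := by
    have h2 : σ 2 = 2 := map_ofNat σ 2
    fin_cases i <;> simp [dihedral, hσ0, hσ1, hσ2, h2]
    · linear_combination (z ^ 2 - 1) * (var k 0 ^ 4 + var k 2 ^ 4) * hz
    · linear_combination -(var k 0 ^ 2 + var k 2 ^ 2) * var k 1 * hz
    · linear_combination -2 * var k 0 * var k 2 * hz
  have hτd (i : Fin 3) : τ (dihedral k i) = dihedral k i := by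
    have h2 : τ 2 = 2 := map_ofNat τ 2
    fin_cases i <;> simp only [dihedral, Fin.zero_eta, Fin.mk_one, Fin.reduceFinMk,
      Matrix.cons_val, map_add, map_mul, map_pow, hτ0, hτ1, hτ2, h2] <;> ring
  have hroot0 (j : ℕ) : Polynomial.aeval (z ^ j * var k 0) h = pullback k φ := by
    induction j with
    | zero => rwa [pow_zero, one_mul]
    | succ j ih =>
      have := key σ hσd (hσ φ) ih
      rwa [map_mul, map_pow, hz', AlgEquiv.commutes, hσ0, ← mul_assoc, ← pow_succ] at this
  have hroot2 (j : ℕ) : Polynomial.aeval (z ^ j * var k 2) h = pullback k φ := by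
    have := key τ hτd (hτ φ) (hroot0 j)
    rwa [map_mul, map_pow, hz', AlgEquiv.commutes, hτ0] at this
  let f : Fin 2 × Fin 4 → RatFunc3 k := fun p => z ^ (p.2 : ℕ) * ![var k 0, var k 2] p.1
  have hf4 (p : Fin 2 × Fin 4) : f p ^ 4 = ![var k 0, var k 2] p.1 ^ 4 := by
    have : (z ^ (p.2 : ℕ)) ^ 4 = 1 := by
      rw [← pow_mul, mul_comm, pow_mul, show z ^ 4 = 1 by linear_combination (z ^ 2 - 1) * hz,
        one_pow]
    rw [mul_pow, this, one_mul]
  have hne : var k 0 ^ 4 ≠ var k 2 ^ 4 := by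
    intro h
    have h : algebraMap (MvPolynomial (Fin 3) k) (RatFunc3 k) (X 0 ^ 4) =
        algebraMap (MvPolynomial (Fin 3) k) (RatFunc3 k) (X 2 ^ 4) := by
      simpa [var] using h
    simpa using congrArg (eval (![1, 0, 0] : Fin 3 → k)) (IsFractionRing.injective _ _ h)
  have hv (b : Fin 2) : ![var k 0, var k 2] b ≠ 0 := by
    fin_cases b <;> exact var_ne_zero _
  have hf : Function.Injective f := by
    rintro ⟨b, j⟩ ⟨b', j'⟩ e
    have e4 := congrArg (· ^ 4) e
    rw [hf4, hf4] at e4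
    obtain rfl : b = b' := by
      fin_cases b <;> fin_cases b' <;> first | rfl | exact absurd e4 hne | exact absurd e4.symm hne
    have ej := mul_right_cancel₀ (hv b) e
    rw [hz', ← map_pow, ← map_pow] at ej
    rw [Fin.ext (hζ4.pow_inj j.2 j'.2 ((algebraMap k (RatFunc3 k)).injective ej))]
  have hp : h.map (algebraMap (dihedralField k) (RatFunc3 k)) -
      Polynomial.C (pullback k φ) = 0 := by
    refine Polynomial.eq_zero_of_natDegree_lt_card_of_eval_eq_zero _ hf ?_ ?_
    · rintro ⟨b, j⟩
      rw [Polynomial.eval_sub, Polynomial.eval_C, Polynomial.eval_map_algebraMap, sub_eq_zero]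
      fin_cases b
      · exact hroot0 j
      · exact hroot2 j
    · rw [Polynomial.natDegree_sub_C, Polynomial.natDegree_map]
      simpa using hdeg
  have h0 := congrArg (Polynomial.coeff · 0) hp
  simp only [Polynomial.coeff_sub, Polynomial.coeff_map, Polynomial.coeff_C_zero,
    Polynomial.coeff_zero, sub_eq_zero] at h0
  rw [← h0]
  exact (h.coeff 0).2

end

/-! ### Algebraic independence and the birational parametrization -/

section
open MvPolynomial
variable {k : Type*} [Field k] [IsAlgClosed k] [CharZero k]

/-- The dihedral invariants as polynomials. -/
noncomputable def dihedralMv (k : Type*) [Field k] : Fin 3 → MvPolynomial (Fin 3) k :=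
  ![X 0 ^ 4 + X 2 ^ 4, (X 0 ^ 2 + X 2 ^ 2) * X 1, 2 * X 0 * X 2]

/-- Since `(a₁² + a₃²)² = u₁ + u₃² / 2` and `(a₁ ± a₃)² = (a₁² + a₃²) ± u₃`, the dihedral invariants
take all values with `u₁ + u₃² / 2 ≠ 0`. -/
lemma exists_eval_dihedralMv_eq (b : Fin 3 → k) (hb : b 0 + b 2 ^ 2 / 2 ≠ 0) :
    ∃ a : Fin 3 → k, (fun i => eval a (dihedralMv k i)) = b := by
  -- `t = a₁² + a₃²`, `r = a₁ + a₃`, `s = a₁ - a₃`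
  obtain ⟨t, ht⟩ := IsAlgClosed.exists_pow_nat_eq (b 0 + b 2 ^ 2 / 2) two_pos
  obtain ⟨r, hr⟩ := IsAlgClosed.exists_pow_nat_eq (t + b 2) two_pos
  obtain ⟨s, hs⟩ := IsAlgClosed.exists_pow_nat_eq (t - b 2) two_pos
  have ht0 : t ≠ 0 := by
    rintro rfl
    exact hb (by rw [← ht]; norm_num)
  have h13 : 2 * ((r + s) / 2) * ((r - s) / 2) = b 2 := by linear_combination (hr - hs) / 2
  have h11 : ((r + s) / 2) ^ 2 + ((r - s) / 2) ^ 2 = t := by linear_combination (hr + hs) / 2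
  refine ⟨![(r + s) / 2, b 1 / t, (r - s) / 2], funext fun i => ?_⟩
  fin_cases i
  · simp only [dihedralMv, Fin.zero_eta, Matrix.cons_val, map_add, map_pow, eval_X]
    generalize (r + s) / 2 = x at *
    generalize (r - s) / 2 = y at *
    linear_combination (x ^ 2 + y ^ 2 + t) * h11 + ht - (2 * x * y + b 2) / 2 * h13
  · simp only [dihedralMv, Fin.mk_one, Matrix.cons_val, map_add, map_mul, map_pow, eval_X]
    rw [h11, mul_div_cancel₀ _ ht0]
  · simp only [dihedralMv, Fin.reduceFinMk, Matrix.cons_val, map_mul, eval_X, map_ofNat]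
    exact h13

lemma algebraicIndependent_dihedral : AlgebraicIndependent k (dihedral k) := by
  have hd : (IsScalarTower.toAlgHom k (MvPolynomial (Fin 3) k) (RatFunc3 k)) ∘ dihedralMv k =
      dihedral k := by
    ext i
    have h2 : algebraMap (MvPolynomial (Fin 3) k) (RatFunc3 k) 2 = 2 := map_ofNat _ 2
    fin_cases i <;> simp [dihedral, dihedralMv, var, h2]
  rw [← hd]
  refine AlgebraicIndependent.map' ?_ (IsFractionRing.injective _ _)
  rw [algebraicIndependent_iff]
  intro F hF
  have hu : (X 0 + C (1 / 2) * X 2 ^ 2 : MvPolynomial (Fin 3) k) ≠ 0 := fun h => by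
    simpa using congrArg (eval (![1, 0, 0] : Fin 3 → k)) h
  refine (mul_eq_zero.1 (MvPolynomial.funext fun b => ?_)).resolve_right hu
  rw [map_mul, map_zero]
  by_cases hb : b 0 + b 2 ^ 2 / 2 = 0
  · have : eval b (X 0 + C (1 / 2) * X 2 ^ 2 : MvPolynomial (Fin 3) k) = 0 := by
      simp only [map_add, map_mul, map_pow, eval_X, eval_C]
      linear_combination hb
    rw [this, mul_zero]
  · obtain ⟨a, rfl⟩ := exists_eval_dihedralMv_eq b hb
    have : (aeval (R := k) a).comp (aeval (dihedralMv k)) =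
        aeval (R := k) fun i => eval a (dihedralMv k i) := by
      ext1 i
      rw [AlgHom.comp_apply, aeval_X, aeval_X, MvPolynomial.aeval_eq_eval]
    have := DFunLike.congr_fun this F
    rw [AlgHom.comp_apply, hF, map_zero, MvPolynomial.aeval_eq_eval] at this
    rw [show eval (fun i => eval a (dihedralMv k i)) F = 0 from this.symm, zero_mul]

lemma range_pullbackField : (pullbackField k).range = (dihedralField k).toSubalgebra :=
  le_antisymm range_pullbackField_le adjoin_dihedral_le

/-- The isomorphism of the rational function field in three variables with `k(ℒ₃)`, through the
common image `k(u₁, u₂, u₃)`. -/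
noncomputable def ratFunc3Equiv (k : Type*) [Field k] [IsAlgClosed k] [CharZero k] :
    RatFunc3 k ≃ₐ[k] FunctionFieldL3 k :=
  (algebraicIndependent_dihedral (k := k)).aevalEquivField.trans <|
    (Subalgebra.equivOfEq _ _ (range_pullbackField (k := k)).symm).trans
      (AlgEquiv.ofInjective (pullbackField k) pullbackField_injective).symm

lemma pullbackField_ratFunc3Equiv (i : Fin 3) :
    pullbackField k (ratFunc3Equiv k (var k i)) = dihedral k i := by
  have h : ((AlgEquiv.ofInjective (pullbackField k) pullbackField_injective)
      (ratFunc3Equiv k (var k i)) : RatFunc3 k) =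
      (algebraicIndependent_dihedral (k := k)).aevalEquivField (var k i) := by
    rw [ratFunc3Equiv, AlgEquiv.trans_apply, AlgEquiv.trans_apply, AlgEquiv.apply_symm_apply]
    rfl
  rw [AlgEquiv.ofInjective_apply] at h
  rw [h, var, AlgebraicIndependent.aevalEquivField_algebraMap_apply_coe, aeval_X]

end

end HyperellipticGenusThree

theorem mainTheorem2 (k : Type*) [Field k] [IsAlgClosed k] [CharZero k] :
    -- `ℒ₃` is irreducible, so `k(ℒ₃)` is a field
    (HyperellipticGenusThree.idealL3 k).IsPrime ∧
    -- pull-back along the normal equation identifies `k(ℒ₃)` with the subfield `k(u₁, u₂, u₃)`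
    ∃ ρ : HyperellipticGenusThree.FunctionFieldL3 k →ₐ[k] HyperellipticGenusThree.RatFunc3 k,
      HyperellipticGenusThree.IsPullback ρ ∧
      Function.Injective ρ ∧
      ρ.range = (IntermediateField.adjoin k
        (Set.range (HyperellipticGenusThree.dihedral k))).toSubalgebra ∧
      -- birational parametrization of `ℒ₃` by the affine 3-space with coordinates `u₁, u₂, u₃`
      AlgebraicIndependent k (HyperellipticGenusThree.dihedral k) ∧
      ∃ e : HyperellipticGenusThree.RatFunc3 k ≃ₐ[k] HyperellipticGenusThree.FunctionFieldL3 k,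
        ∀ i, ρ (e (HyperellipticGenusThree.var k i)) = HyperellipticGenusThree.dihedral k i := by
  open HyperellipticGenusThree in
  exact ⟨isPrime_idealL3, pullbackField k, isPullback_pullbackField, pullbackField_injective,
    range_pullbackField, algebraicIndependent_dihedral, ratFunc3Equiv k,
    pullbackField_ratFunc3Equiv⟩
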